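/- **Definitions.** Let $\lambda$ be an infinite cardinal. A *full $\lambda$-parameter* $\mathfrak x$ consists of an ordinal $\alpha^*=\alpha^*_{\mathfrak x}\le\lambda$; sets $I$, $J$, a set $S\subseteq I\times I$ and a function $s\mapsto u_s\subseteq\lambda$ on $I$; a function $t\mapsto s_t$ from $J$ to $I$ and a set $T\subseteq J\times J$ such that $(t_1,t_2)\in T\Rightarrow(s_{t_1},s_{t_2})\in S$; and, for each $t\in J$, an ordinal $\alpha_t<\alpha^*$, a function $g_t:u_{s_t}\to\alpha_t$ and a non-decreasing function $h_t:u_{s_t}\to\lambda$, such that $t$ is determined by $(s_t,\alpha_t,g_t,h_t)$ (functions $g$ are always taken together with their codomain $\alpha_t$); we write $t=t(s_t,\alpha_t,g_t,h_t)$. It is a full $(\lambda,\theta)$-parameter if $|u_s|<\theta$ for all $s\in I$. $\mathbb G_s$ is the group freely generated by $\{x_t:t\in J,\ s_t=s\}$, with unit $e$. For $(s_1,s_2)\in S$, $\mathbb G_{s_1,s_2}$ is the subgroup of $\mathbb G_{s_1}\times\mathbb G_{s_2}$ generated by the pairs $(x_{t_1},x_{t_2})$ with $(t_1,t_2)\in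 T$, $s_{t_1}=s_1$, $s_{t_2}=s_2$. The model $M_{\mathfrak x}$ has universe $\{(s,y):s\in I,\ y\in\mathbb G_s\}$, unary predicates $P_s=\{s\}\times\mathbb G_s$ for $s\in I$, binary predicates $Q_{s_1,s_2}=\{((s_1,y_1),(s_2,y_2)):(y_1,y_2)\in\mathbb G_{s_1,s_2}\}$ for $(s_1,s_2)\in S$, and unary functions $F_{s,a}$ for $s\in I$, $a\in\mathbb G_s$, where $F_{s,a}(s,y)=(s,ay)$ and $F_{s,a}$ is the identity outside $P_s$. $M_{\mathfrak x}$ is *$P_s$-rigid* if every automorphism of $M_{\mathfrak x}$ is the identity on $P_s$. For $\alpha<\alpha^*$ and $\beta<\lambda$ let $\mathcal G_{\alpha,\beta}$ be the set of non-decreasing $g:\beta\to\alpha$. For such $g$ let $h_g:\beta\to\lambda$, $h_g(\gamma)=\min\{\beta'\le\beta:\text{ if }\beta'<\beta\text{ then }g(\beta')>g(\gamma)\}$. *Condition $\circledast_1$ for $s$*: there is no family $\langle c_r:r\in I\rangle$ with $c_r\in\mathbb G_r$ for all $r$, $(c_{r_1},c_{r_2})\in\mathbb G_{r_1,r_2}$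 for all $(r_1,r_2)\in S$, and $c_s\ne e$. *Condition $\circledast_{2,\alpha}$ for $s(*)\in I$ and $t^*\in J$*: (i) $\lambda$ is regular and $|u_s|<\lambda$ for every $s\in I$; (ii) if $s\in I$, $g\in\mathcal G_{\alpha',\beta}$ for some $\alpha'<\alpha^*$, $\beta<\lambda$, and $u_s\subseteq\beta$, then $t(s,\alpha',g\restriction u_s,h_g\restriction u_s)$ exists; (iii) if $t_1,t_2\in J$, $(s_{t_1},s_{t_2})\in S$, and for some $\alpha'<\alpha^*$, $\beta<\lambda$ and $g\in\mathcal G_{\alpha',\beta}$ we have $\alpha_{t_1}=\alpha_{t_2}=\alpha'$, $u_{s_{t_1}}\cup u_{s_{t_2}}\subseteq\beta$, $g_{t_1}\cup g_{t_2}\subseteq g$ and $h_{t_1}\cup h_{t_2}\subseteq h_g$, then $(t_1,t_2)\in T$; (iv) $t^*=t(s(*),\alpha,g,h)$, where $g:u_{s(*)}\to\alpha$ is constantly $0$ and $h$ is constantly $\bigcup\{\gamma+1:\gamma\in u_{s(*)}\}$. *The game.* For models $M_1,M_2$ of the same vocabulary, an ordinal $\alpha$ and a cardinal $\mu$, the game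 of length $\alpha$ goes as follows. The positions $f_\beta$ ($\beta\le\alpha$) are partial isomorphisms from $M_1$ to $M_2$ (partial maps preserving and reflecting atomic formulas), $f_0=\emptyset$ and $f_\beta=\bigcup_{\gamma<\beta}f_\gamma$ for limit $\beta$; in the $(\beta+1)$-th move ($\beta<\alpha$) player AIS chooses $A_1\subseteq M_1$ and $A_2\subseteq M_2$ with $|A_1|+|A_2|<1+\mu$, and then player ISO chooses $f_{\beta+1}\supseteq f_\beta$ with $A_1\subseteq\mathrm{Dom}(f_{\beta+1})$ and $A_2\subseteq\mathrm{Rang}(f_{\beta+1})$. ISO loses if he has no legal move. $M_1,M_2$ are *EF$_{\alpha,\mu}$-equivalent* if ISO has a winning strategy. **Claim.** Let $\lambda$ be a cardinal with $\lambda=\mathrm{cf}(\lambda)=\lambda^{\aleph_0}$ and let $\alpha^*\le\lambda$ be an ordinal. Then there is a full $(\lambda,\aleph_1)$-parameter $\mathfrak x$ with $\alpha^*_{\mathfrak x}=\alpha^*$, with index set $I=[\lambda]^{\le\aleph_0}$ and with $u_s=s$ for $s\in I$, such that: (1) for every $s\in I$ the condition $\circledast_1$ holds and $M_{\mathfrak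 x}$ is $P_s$-rigid; and for every $s(*)\in I\setminus\{\emptyset\}$ and every $\alpha$ with $0<\alpha<\alpha^*$ the condition $\circledast_{2,\alpha}$ holds for $s(*)$ and some $t^*\in J$; (2) if $\alpha^*>1$, then for every $s\in I\setminus\{\emptyset\}$ there are $c_1\ne c_2$ in $P_s$ such that $(M_{\mathfrak x},c_1)$ and $(M_{\mathfrak x},c_2)$ are EF$_{\alpha,\lambda}$-equivalent for every $\alpha<\alpha^*$, but not EF$_{\alpha^*,\lambda}$-equivalent. -/

import Mathlib

open Cardinal Ordinal FirstOrder

universe u v w o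

noncomputable section

namespace LongEF

/-! ### The Ehrenfeucht–Fraïssé game -/

section Game

variable (L : FirstOrder.Language.{v, w}) (M N : Type u) [L.Structure M] [L.Structure N]

/-- A partial isomorphism from `M` to `N`, given by its graph `f`: the correspondence preserves and
reflects all atomic formulas.  Comparing equalities of variables shows that `f` is the graph of an
injective partial function; `f` is a partial isomorphism iff it extends to an isomorphism between
the generated substructures. -/
structure IsPartialIso (f : Set (M × N)) : Prop where
  equal_iff : ∀ t₁ t₂ : L.Term f,
    t₁.realize (fun p => p.1.1) = t₂.realize (fun p => p.1.1) ↔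
      t₁.realize (fun p => p.1.2) = t₂.realize (fun p => p.1.2)
  rel_iff : ∀ {n : ℕ} (R : L.Relations n) (ts : Fin n → L.Term f),
    Language.Structure.RelMap R (fun i => (ts i).realize (fun p => (p.1.1 : M))) ↔
      Language.Structure.RelMap R (fun i => (ts i).realize (fun p => (p.1.2 : N)))

variable {M N}

/-- A legal sequence of moves of the player AIS in the game of length `α`: in the `(β + 1)`-th
move AIS chooses `A β = (A₁, A₂)` with `|A₁| + |A₂| < 1 + μ`. -/
def LegalMoves (α : Ordinal.{o}) (μ : Cardinal.{u}) (A : Ordinal.{o} → Set M × Set N) : Prop :=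
  ∀ β < α, #(A β).1 + #(A β).2 < 1 + μ

/-- `σ` is a winning strategy of the player ISO in the game of length `α` and width `μ` starting
at the partial isomorphism `f₀`.  Here `σ A β` is the position `f_β` after `β` moves of the play in
which AIS plays `A` and ISO follows the strategy; it depends only on the moves of AIS made so far,
that is on `A γ` for `γ < β`. -/
structure IsWinningStrategy (f₀ : Set (M × N)) (α : Ordinal.{o}) (μ : Cardinal.{u})
    (σ : (Ordinal.{o} → Set M × Set N) → Ordinal.{o} → Set (M × N)) : Prop where
  nonanticipating : ∀ A A' : Ordinal.{o} → Set M × Set N, ∀ β ≤ α,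
    (∀ γ < β, A γ = A' γ) → σ A β = σ A' β
  zero : ∀ A, LegalMoves α μ A → σ A 0 = f₀
  partialIso : ∀ A, LegalMoves α μ A → ∀ β ≤ α, IsPartialIso L M N (σ A β)
  succ_extends : ∀ A, LegalMoves α μ A → ∀ β < α, σ A β ⊆ σ A (Order.succ β)
  succ_dom : ∀ A, LegalMoves α μ A → ∀ β < α, (A β).1 ⊆ Prod.fst '' σ A (Order.succ β)
  succ_ran : ∀ A, LegalMoves α μ A → ∀ β < α, (A β).2 ⊆ Prod.snd '' σ A (Order.succ β)
  limit : ∀ A, LegalMoves α μ A → ∀ β ≤ α, Order.IsSuccLimit β →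
    σ A β = ⋃ γ ∈ Set.Iio β, σ A γ

variable (M N)

/-- `M` and `N` are EF_{α,μ}-equivalent: ISO has a winning strategy in the game of length `α` and
width `μ` starting at the empty map. -/
def EFEquiv (α : Ordinal.{o}) (μ : Cardinal.{u}) : Prop :=
  ∃ σ, IsWinningStrategy L (∅ : Set (M × N)) α μ σ

end Game

/-- The type `M`, as the carrier of the expansion `(M, c)` of `M` by the individual constant `c`. -/
@[nolint unusedArguments]
def Pointed {M : Type u} (_c : M) : Type u := M

instance {L : FirstOrder.Language.{v, w}} {M : Type u} [S : L.Structure M] (c : M) :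
    L.Structure (Pointed c) := S

instance {M : Type u} (c : M) : (Language.constantsOn Unit).Structure (Pointed c) :=
  Language.constantsOn.structure (fun _ => (c : M))

/-- The expansions `(M, c₁)` and `(M, c₂)`, in the vocabulary of `M` with one additional individual
constant, are EF_{α,μ}-equivalent. -/
def PointedEFEquiv (L : FirstOrder.Language.{v, w}) (M : Type u) [L.Structure M] (c₁ c₂ : M)
    (α : Ordinal.{o}) (μ : Cardinal.{u}) : Prop :=
  EFEquiv (L.withConstants Unit) (Pointed c₁) (Pointed c₂) α μ

/-! ### Parameters -/

/-- A `lam`-parameter with index sets `I` and `J`.  Ordinals below the cardinal `lam` are the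
ordinals below `lam.ord`. -/
structure Parameter (lam : Cardinal.{u}) (I : Type v) (J : Type w) where
  /-- the ordinal `α^*` -/
  alphaStar : Ordinal.{u}
  alphaStar_le : alphaStar ≤ lam.ord
  S : Set (I × I)
  /-- the function `𝐮` from `I` to the power set of `lam` -/
  u : I → Set Ordinal.{u}
  u_subset : ∀ s, u s ⊆ Set.Iio lam.ord
  /-- the function `𝐬` from `J` to `I` -/
  s : J → I
  T : Set (J × J)
  T_subset : ∀ t₁ t₂, (t₁, t₂) ∈ T → (s t₁, s t₂) ∈ S

/-- A full `lam`-parameter: each `t` comes with an ordinal `α_t < α^*`, a function `g t` from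
`u (s t)` to `α_t` and a non-decreasing function `h t` from `u (s t)` to `lam`, such that `t` is
determined by `s t`, `h t` and the function `g t` together with its codomain `α_t`.
Only the values of `g t` and `h t` on `u (s t)` are used. -/
structure FullParameter (lam : Cardinal.{u}) (I : Type v) (J : Type w) extends
    Parameter lam I J where
  alpha : J → Ordinal.{u}
  alpha_lt : ∀ t, alpha t < alphaStar
  g : J → Ordinal.{u} → Ordinal.{u}
  g_mapsTo : ∀ t, Set.MapsTo (g t) (u (s t)) (Set.Iio (alpha t))
  h : J → Ordinal.{u} → Ordinal.{u}
  h_mapsTo : ∀ t, Set.MapsTo (h t) (u (s t)) (Set.Iio lam.ord)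
  h_monotoneOn : ∀ t, MonotoneOn (h t) (u (s t))
  eq_of_eq : ∀ t₁ t₂, s t₁ = s t₂ → alpha t₁ = alpha t₂ →
    Set.EqOn (g t₁) (g t₂) (u (s t₁)) → Set.EqOn (h t₁) (h t₂) (u (s t₁)) → t₁ = t₂

namespace Parameter

variable {lam : Cardinal.{u}} {I : Type v} {J : Type w} (x : Parameter lam I J)

/-- `x` is a `(lam, θ)`-parameter. -/
def IsBounded (θ : Cardinal.{u}) : Prop :=
  ∀ s, #(x.u s) < Cardinal.lift.{u + 1} θ

/-- The group `𝔾_s`, freely generated by the `x_t` for `t ∈ J_s = {t ∈ J | s t = s}`. -/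
abbrev G (s : I) : Type w := FreeGroup {t : J // x.s t = s}

/-- The subgroup `𝔾_{s₁,s₂}` of `𝔾_{s₁} × 𝔾_{s₂}` generated by the pairs `(x_{t₁}, x_{t₂})` with
`(t₁, t₂) ∈ T`. -/
def G₂ (s₁ s₂ : I) : Subgroup (x.G s₁ × x.G s₂) :=
  Subgroup.closure {p | ∃ (t₁ : {t : J // x.s t = s₁}) (t₂ : {t : J // x.s t = s₂}),
    (t₁.1, t₂.1) ∈ x.T ∧ p = (FreeGroup.of t₁, FreeGroup.of t₂)}

/-- Function symbols of the vocabulary: a unary `F_{s,a}` for `s ∈ I` and `a ∈ 𝔾_s`. -/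
inductive FunSymb : ℕ → Type (max v w)
  | F (s : I) (a : x.G s) : FunSymb 1

/-- Relation symbols of the vocabulary: a unary `P_s` for `s ∈ I` and a binary `Q_{s₁,s₂}` for
`(s₁, s₂) ∈ S`. -/
inductive RelSymb : ℕ → Type v
  | P (s : I) : RelSymb 1
  | Q (s₁ s₂ : I) (hs : (s₁, s₂) ∈ x.S) : RelSymb 2

/-- The vocabulary of the model `M_x`. -/
def lang : FirstOrder.Language.{max v w, v} where
  Functions := x.FunSymb
  Relations := x.RelSymb

/-- The universe `{(s, y) | s ∈ I, y ∈ 𝔾_s}` of the model `M_x`. -/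
def Model : Type (max v w) := Σ s : I, x.G s

/-- The interpretation of `P_s`. -/
def P (s : I) : Set x.Model := {y | y.1 = s}

/-- The interpretation of `Q_{s₁,s₂}`. -/
def Q (s₁ s₂ : I) (y z : x.Model) : Prop :=
  ∃ (y₁ : x.G s₁) (z₁ : x.G s₂), y = ⟨s₁, y₁⟩ ∧ z = ⟨s₂, z₁⟩ ∧ (y₁, z₁) ∈ x.G₂ s₁ s₂

open Classical in
/-- The interpretation of `F_{s,a}`: left multiplication by `a` on `P_s`, the identity outside. -/
def F (s : I) (a : x.G s) (y : x.Model) : x.Model :=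
  if hy : y.1 = s then ⟨s, a * (hy ▸ y.2)⟩ else y

/-- The model `M_x`. -/
instance : x.lang.Structure x.Model where
  funMap := fun {_n} f xs => match f, xs with
    | FunSymb.F s a, xs => x.F s a (xs 0)
  RelMap := fun {_n} R xs => match R, xs with
    | RelSymb.P s, xs => xs 0 ∈ x.P s
    | RelSymb.Q s₁ s₂ _, xs => x.Q s₁ s₂ (xs 0) (xs 1)

/-- `M_x` is `P_s`-rigid: every automorphism of `M_x` is the identity on `P_s`. -/
def IsRigidAt (s : I) : Prop :=
  ∀ f : x.Model ≃[x.lang] x.Model, ∀ y ∈ x.P s, f y = y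

/-- The set `𝐂_{I'}` of families `c` with `c s ∈ 𝔾_s` such that `(c s₁, c s₂) ∈ 𝔾_{s₁,s₂}` whenever
`s₁, s₂ ∈ I'` and `(s₁, s₂) ∈ S`. -/
def C (I' : Set I) : Set (∀ s : I', x.G s) :=
  {c | ∀ s₁ s₂ : I', (s₁.1, s₂.1) ∈ x.S → (c s₁, c s₂) ∈ x.G₂ s₁ s₂}

/-- The condition `⊛₁` for `I'` and `s ∈ I'`: no `c ∈ 𝐂_{I'}` has `c s ≠ e`. -/
def CondOne (I' : Set I) (s : I') : Prop :=
  ¬ ∃ c ∈ x.C I', c s ≠ 1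

end Parameter

/-- The function `h_g : β → lam` attached to `g` with domain `β`:
`h_g γ = min {β' ≤ β | if β' < β then g β' > g γ}`. -/
def hOf (β : Ordinal.{u}) (g : Ordinal.{u} → Ordinal.{u}) (γ : Ordinal.{u}) : Ordinal.{u} :=
  sInf {β' | β' ≤ β ∧ (β' < β → g γ < g β')}

namespace FullParameter

variable {lam : Cardinal.{u}} {I : Type v} {J : Type w} (x : FullParameter lam I J)

/-- `g` (restricted to `β`) belongs to `𝒢_{α,β}`: `α < α^*`, `β < lam`, and `g` is a non-decreasing
function from `β` to `α`. -/
structure MemG (α β : Ordinal.{u}) (g : Ordinal.{u} → Ordinal.{u}) : Prop where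
  lt_alphaStar : α < x.alphaStar
  lt_lam : β < lam.ord
  mapsTo : Set.MapsTo g (Set.Iio β) (Set.Iio α)
  monotoneOn : MonotoneOn g (Set.Iio β)

/-- `t = t_{s,g,h}`, where `g` and `h` are restricted to `u s` and `α` is the codomain of `g`. -/
structure IsIndex (t : J) (s : I) (α : Ordinal.{u}) (g h : Ordinal.{u} → Ordinal.{u}) : Prop where
  s_eq : x.s t = s
  alpha_eq : x.alpha t = α
  g_eq : Set.EqOn (x.g t) g (x.u s)
  h_eq : Set.EqOn (x.h t) h (x.u s)

/-- The condition `⊛_{2,α}` for `s⋆ ∈ I` and `t⋆ ∈ J`. -/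
structure CondTwo (sStar : I) (α : Ordinal.{u}) (tStar : J) : Prop where
  regular : lam.IsRegular
  card_lt : x.IsBounded lam
  exists_index : ∀ (s : I) (α' β : Ordinal.{u}) (g : Ordinal.{u} → Ordinal.{u}),
    x.MemG α' β g → x.u s ⊆ Set.Iio β → ∃ t, x.IsIndex t s α' g (hOf β g)
  mem_T : ∀ t₁ t₂ : J, (x.s t₁, x.s t₂) ∈ x.S →
    (∃ (α' β : Ordinal.{u}) (g : Ordinal.{u} → Ordinal.{u}), x.MemG α' β g ∧
      x.u (x.s t₁) ⊆ Set.Iio β ∧ x.u (x.s t₂) ⊆ Set.Iio β ∧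
      x.IsIndex t₁ (x.s t₁) α' g (hOf β g) ∧ x.IsIndex t₂ (x.s t₂) α' g (hOf β g)) →
    (t₁, t₂) ∈ x.T
  /-- `t⋆ = t_{s⋆,g,h}`, where `g : u s⋆ → α` is constantly `0` and `h` is constantly
  `⋃ {γ + 1 | γ ∈ u s⋆}` -/
  index_tStar : x.IsIndex tStar sStar α (fun _ => 0) (fun _ => sSup (Order.succ '' x.u sStar))

end FullParameter

/-- The set `[lam]^{≤ ℵ₀}` of countable subsets of `lam`. -/
def CountableSubsets (lam : Cardinal.{u}) : Type (u + 1) :=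
  {a : Set Ordinal.{u} // a ⊆ Set.Iio lam.ord ∧ a.Countable}

end LongEF

end

/-!
The generators of all groups are *letters*: restrictions to countable sets of *threads*, that is,
of non-decreasing functions `g : β → α` with `α < α^*` and `β < lam`, where each point `γ` is
marked by `α`, `g γ` and `hOf β g γ`. In addition, a thread may have a root `δ`: below `δ` it does
not disclose `α` and `g`, but looks like the constant function `0 : δ → 1`. Letters restrict to
smaller indices, `T` is the graph of these restrictions, and hence `𝔾_{s₁,s₂}` is the graph of the
induced homomorphism `𝔾_{s₂} → 𝔾_{s₁}` (`rootedParameter`, `Parameter.mem_G₂_iff_of_graph`). A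
full parameter requires a monotone function `h_t` that together with `g` determines the letter;
the root is coded into it as `h * h + δ`, which is possible since `δ < h`.

*Rigidity* (`condOne`). In a compatible family of group elements the number of letters that occur
grows with the index, and is bounded because countably many countable sets have a countable union.
Where it is maximal, letters extend uniquely, so that a nontrivial family yields a thread through
all of `lam`. Beyond its first bound, such a thread takes a new value whenever a bound is passed,
although its values lie below some `α < α^* ≤ lam`; this contradicts the regularity of `lam`.

*ISO wins the games of length `α < α^*`* between `(s, e)` and `(s, x_t)`, where `t` consists of a
root `b` above `s` only (`pointedEFEquiv_of_lt`). He multiplies by the letters of a thread with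
root `b` and codomain `max 1 α`, which he builds during the play; in the `j`-th move he continues
it by the value `j` beyond all indices met by the sets of AIS. The root is what makes this work for
all `α` with one and the same `t`.

*AIS wins the game of length `α^*`* (`not_pointedEFEquiv`). He asks for images of `(r, e)` only,
and so learns group elements, compatible on the indices asked for, that start with the generator
`x_t` at `s`. He first asks for one more point beyond the root, where some letter `t₁` over `t`
discloses its codomain `a < α^*`, and in the `i`-th move for a height `β i` beyond all bounds met
before. It follows by induction on `i` that over some finite set of heights some letter over `t₁`
has a value `≥ i` at `β i`; for `i = a` this is absurd. The induction is easy at successors. At a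
limit `i`, AIS asks for a union of countably many of the earlier witnesses, along an `ω`-sequence
in `i`. A letter `T` over this union that extends infinitely many witnessing letters has at `β i`
a value above this sequence. Finitely many witnesses suffice to tell the letters over the union
apart, so `T` restricts to a letter over a finite set; the values below `i` over finite sets are
bounded by a function `φ` with values below `i`, so if the sequence escapes `φ`, the value of `T`
is at least `i`. The function `φ` is not known beforehand, but there are only `|i|` many sequences
to be tried, which is less than `lam` (`exists_ladder_family`, `IsGoodPlay.exists_witness_limit`).
-/

noncomputable section

namespace LongEF

open Set

/-! ### The function `hOf` -/

section HOf

variable {β γ γ' : Ordinal.{u}} {g : Ordinal.{u} → Ordinal.{u}}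

theorem hOf_mem (β : Ordinal.{u}) (g : Ordinal.{u} → Ordinal.{u}) (γ : Ordinal.{u}) :
    hOf β g γ ≤ β ∧ (hOf β g γ < β → g γ < g (hOf β g γ)) :=
  csInf_mem (s := {β' | β' ≤ β ∧ (β' < β → g γ < g β')}) ⟨β, le_rfl, fun h => (lt_irrefl _ h).elim⟩

theorem hOf_le (β : Ordinal.{u}) (g : Ordinal.{u} → Ordinal.{u}) (γ : Ordinal.{u}) :
    hOf β g γ ≤ β := (hOf_mem β g γ).1

theorem hOf_le_of_lt (h : γ' ≤ β) (h' : γ' < β → g γ < g γ') : hOf β g γ ≤ γ' :=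
  csInf_le' ⟨h, h'⟩

theorem lt_hOf (hg : MonotoneOn g (Iio β)) (hγ : γ < β) : γ < hOf β g γ := by
  by_contra! h
  have h1 := (hOf_mem β g γ).2 (h.trans_lt hγ)
  exact (hg (h.trans_lt hγ) hγ h).not_gt h1

theorem lt_of_hOf_le (hg : MonotoneOn g (Iio β)) (hγ : γ' < β) (h : hOf β g γ ≤ γ') :
    g γ < g γ' :=
  ((hOf_mem β g γ).2 (h.trans_lt hγ)).trans_le (hg (h.trans_lt hγ) hγ h)

theorem hOf_mono (h : g γ ≤ g γ') : hOf β g γ ≤ hOf β g γ' :=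
  hOf_le_of_lt (hOf_le _ _ _) fun h' => h.trans_lt ((hOf_mem β g γ').2 h')

theorem hOf_const (β c γ : Ordinal.{u}) : hOf β (fun _ => c) γ = β := by
  by_contra h
  exact lt_irrefl _ ((hOf_mem β (fun _ => c) γ).2 (lt_of_le_of_ne (hOf_le _ _ _) h))

end HOf

/-! ### Threads and letters -/

/-- The information carried by a generator at a point `γ` of its index: the codomain of the
non-decreasing function `g`, the value `g γ`, and the point `bound` at which `g` first exceeds this
value. -/
structure Mark : Type (u + 1) where
  cod : Ordinal.{u}
  val : Ordinal.{u}
  bound : Ordinal.{u}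

/-- `g`, restricted to `β`, is a non-decreasing function from `β` to `α`, where `α < α^*` and
`β < lam`. -/
structure Grows (lam : Cardinal.{u}) (alphaStar α β : Ordinal.{u})
    (g : Ordinal.{u} → Ordinal.{u}) : Prop where
  cod_lt : α < alphaStar
  dom_lt : β < lam.ord
  mapsTo : MapsTo g (Iio β) (Iio α)
  monotoneOn : MonotoneOn g (Iio β)

/-- The marks of the thread with root `δ` that climbs along `g : β → α`.  Below `δ` it does not
disclose `α`: it looks there like the constant function `0 : δ → 1`. -/
def thread (δ α β : Ordinal.{u}) (g : Ordinal.{u} → Ordinal.{u}) (γ : Ordinal.{u}) : Mark.{u} :=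
  if γ < δ then ⟨1, 0, δ⟩ else ⟨α, g γ, hOf β g γ⟩

theorem thread_of_lt {δ α β γ : Ordinal.{u}} {g : Ordinal.{u} → Ordinal.{u}} (h : γ < δ) :
    thread δ α β g γ = ⟨1, 0, δ⟩ := if_pos h

theorem thread_of_le {δ α β γ : Ordinal.{u}} {g : Ordinal.{u} → Ordinal.{u}} (h : δ ≤ γ) :
    thread δ α β g γ = ⟨α, g γ, hOf β g γ⟩ := if_neg h.not_gt

/-- The indices of the generators of all groups `𝔾_s`.  A letter is the restriction of a thread to
a countable set `idx`.  The root is recorded only if it separates points of `idx`; otherwise it is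
`0`, and the letter is one of those whose existence `FullParameter.CondTwo` asks for. -/
@[ext]
structure Letter (lam : Cardinal.{u}) (alphaStar : Ordinal.{u}) : Type (u + 1) where
  idx : CountableSubsets lam
  cod : Ordinal.{u}
  root : Ordinal.{u}
  g : Ordinal.{u} → Ordinal.{u}
  h : Ordinal.{u} → Ordinal.{u}
  g_eq_zero : ∀ γ, ¬ (γ ∈ idx.1 ∧ root ≤ γ) → g γ = 0
  h_eq_zero : ∀ γ, ¬ (γ ∈ idx.1 ∧ root ≤ γ) → h γ = 0
  root_spec : root = 0 ∨ 1 < alphaStar ∧ (∃ γ ∈ idx.1, γ < root) ∧ ∃ γ ∈ idx.1, root ≤ γ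
  exists_grows : ∃ β g', Grows lam alphaStar cod β g' ∧ idx.1 ⊆ Iio β ∧
    ∀ γ ∈ idx.1, root ≤ γ → g γ = g' γ ∧ h γ = hOf β g' γ

namespace Letter

variable {lam : Cardinal.{u}} {alphaStar : Ordinal.{u}} (t : Letter lam alphaStar)
  {γ γ' γ₀ : Ordinal.{u}}

/-- The mark of a letter at a point of its index. -/
def mark (γ : Ordinal.{u}) : Mark.{u} :=
  if γ < t.root then ⟨1, 0, t.root⟩ else ⟨t.cod, t.g γ, t.h γ⟩

theorem mark_of_lt (h : γ < t.root) : t.mark γ = ⟨1, 0, t.root⟩ := if_pos h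

theorem mark_of_le (h : t.root ≤ γ) : t.mark γ = ⟨t.cod, t.g γ, t.h γ⟩ := if_neg h.not_gt

theorem exists_thread : ∃ β g, Grows lam alphaStar t.cod β g ∧ t.idx.1 ⊆ Iio β ∧
    ∀ γ ∈ t.idx.1, t.mark γ = thread t.root t.cod β g γ := by
  obtain ⟨β, g, hg, hβ, h⟩ := t.exists_grows
  refine ⟨β, g, hg, hβ, fun γ hγ => ?_⟩
  rcases lt_or_ge γ t.root with h1 | h1
  · rw [mark_of_lt _ h1, thread_of_lt h1]
  · rw [mark_of_le _ h1, thread_of_le h1, (h γ hγ h1).1, (h γ hγ h1).2]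

theorem cod_lt : t.cod < alphaStar := by
  obtain ⟨β, g, hg, -⟩ := t.exists_grows
  exact hg.cod_lt

theorem lt_h (hγ : γ ∈ t.idx.1) (hr : t.root ≤ γ) : γ < t.h γ := by
  obtain ⟨β, g, hg, hβ, h⟩ := t.exists_grows
  rw [(h γ hγ hr).2]
  exact lt_hOf hg.monotoneOn (hβ hγ)

theorem h_lt (hγ : γ ∈ t.idx.1) (hr : t.root ≤ γ) : t.h γ < lam.ord := by
  obtain ⟨β, g, hg, hβ, h⟩ := t.exists_grows
  rw [(h γ hγ hr).2]
  exact (hOf_le _ _ _).trans_lt hg.dom_lt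

theorem g_lt (hγ : γ ∈ t.idx.1) (hr : t.root ≤ γ) : t.g γ < t.cod := by
  obtain ⟨β, g, hg, hβ, h⟩ := t.exists_grows
  rw [(h γ hγ hr).1]
  exact hg.mapsTo (hβ hγ)

theorem h_mono (hγ : γ ∈ t.idx.1) (hγ' : γ' ∈ t.idx.1) (hr : t.root ≤ γ) (hle : γ ≤ γ') :
    t.h γ ≤ t.h γ' := by
  obtain ⟨β, g, hg, hβ, h⟩ := t.exists_grows
  rw [(h γ hγ hr).2, (h γ' hγ' (hr.trans hle)).2]
  exact hOf_mono (hg.monotoneOn (hβ hγ) (hβ hγ') hle)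

theorem g_lt_g (hγ : γ ∈ t.idx.1) (hγ' : γ' ∈ t.idx.1) (hr : t.root ≤ γ) (hr' : t.root ≤ γ')
    (hle : t.h γ ≤ γ') : t.g γ < t.g γ' := by
  obtain ⟨β, g, hg, hβ, h⟩ := t.exists_grows
  rw [(h γ hγ hr).2] at hle
  rw [(h γ hγ hr).1, (h γ' hγ' hr').1]
  exact lt_of_hOf_le hg.monotoneOn (hβ hγ') hle

theorem root_lt (hlam : ℵ₀ ≤ lam) : t.root < lam.ord := by
  rcases t.root_spec with h | ⟨-, -, γ, hγ, h⟩
  · rw [h]; exact (ord_pos.2 (aleph0_pos.trans_le hlam))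
  · exact h.trans_lt (t.idx.2.1 hγ)

theorem mark_val_lt_cod (hγ : γ ∈ t.idx.1) : (t.mark γ).val < (t.mark γ).cod := by
  rcases lt_or_ge γ t.root with h | h
  · simp [mark_of_lt _ h]
  · rw [mark_of_le _ h]; exact t.g_lt hγ h

theorem mark_cod_lt (γ : Ordinal.{u}) : (t.mark γ).cod < alphaStar := by
  rcases lt_or_ge γ t.root with h | h
  · rw [mark_of_lt _ h]
    rcases t.root_spec with h' | h'
    · simp [h'] at h
    · exact h'.1
  · rw [mark_of_le _ h]; exact t.cod_lt

theorem lt_mark_bound (hγ : γ ∈ t.idx.1) : γ < (t.mark γ).bound := by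
  rcases lt_or_ge γ t.root with h | h
  · rw [mark_of_lt _ h]; exact h
  · rw [mark_of_le _ h]; exact t.lt_h hγ h

theorem mark_bound_lt (hlam : ℵ₀ ≤ lam) (hγ : γ ∈ t.idx.1) : (t.mark γ).bound < lam.ord := by
  rcases lt_or_ge γ t.root with h | h
  · rw [mark_of_lt _ h]; exact t.root_lt hlam
  · rw [mark_of_le _ h]; exact t.h_lt hγ h

theorem root_le_of_bound_le (hγ₀ : γ₀ ∈ t.idx.1) (h : (t.mark γ₀).bound ≤ γ) : t.root ≤ γ := by
  rcases lt_or_ge γ₀ t.root with h' | h'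
  · rw [mark_of_lt _ h'] at h; exact h
  · exact h'.trans ((t.lt_mark_bound hγ₀).le.trans h)

/-- Beyond the bound at some point, a letter has left its root. -/
theorem mark_cod_of_bound_le (hγ₀ : γ₀ ∈ t.idx.1) (h : (t.mark γ₀).bound ≤ γ) :
    (t.mark γ).cod = t.cod := by
  rw [mark_of_le _ (t.root_le_of_bound_le hγ₀ h)]

/-- Beyond the bound at some point, the values of a letter increase whenever a bound is passed. -/
theorem mark_val_lt_val (hγ₀ : γ₀ ∈ t.idx.1) (hγ : γ ∈ t.idx.1) (hγ' : γ' ∈ t.idx.1)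
    (h : (t.mark γ₀).bound ≤ γ) (h' : (t.mark γ).bound ≤ γ') :
    (t.mark γ).val < (t.mark γ').val := by
  have h1 := t.root_le_of_bound_le hγ₀ h
  have h2 := t.root_le_of_bound_le hγ h'
  rw [mark_of_le _ h1] at h' ⊢
  rw [mark_of_le _ h2]
  exact t.g_lt_g hγ hγ' h1 h2 h'

variable {t} in
/-- A root that separates points of the index can be read off from the marks. -/
theorem root_eq_of_mark_eq {t' : Letter lam alphaStar} (hidx : t.idx = t'.idx)
    (hm : ∀ γ ∈ t.idx.1, t.mark γ = t'.mark γ) (h0 : t.root ≠ 0) : t.root = t'.root := by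
  rcases t.root_spec with h | ⟨-, ⟨γ₀, hγ₀, h₀⟩, γ₁, hγ₁, h₁⟩
  · exact (h0 h).elim
  have e0 := hm γ₀ hγ₀
  rw [mark_of_lt _ h₀] at e0
  rcases lt_or_ge γ₀ t'.root with h | h
  · rw [mark_of_lt _ h] at e0
    exact congrArg Mark.bound e0
  · exfalso
    rw [mark_of_le _ h] at e0
    have e1 := congrArg Mark.cod e0
    have e2 := congrArg Mark.val e0
    have e3 := congrArg Mark.bound e0
    simp only at e1 e2 e3
    have h3 := t'.g_lt_g (hidx ▸ hγ₀) (hidx ▸ hγ₁) h (h.trans (h₀.le.trans h₁)) (e3 ▸ h₁)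
    have h4 := t'.g_lt (hidx ▸ hγ₁) (h.trans (h₀.le.trans h₁))
    rw [← e1, Order.lt_one_iff] at h4
    rw [h4] at h3
    simp at h3

/-- A letter with nonempty index is determined by its index and its marks. -/
theorem eq_of_mark_eq {t' : Letter lam alphaStar} (hidx : t.idx = t'.idx)
    (hne : t.idx.1.Nonempty) (hm : ∀ γ ∈ t.idx.1, t.mark γ = t'.mark γ) : t = t' := by
  have hroot : t.root = t'.root := by
    by_cases h : t.root = 0
    · by_cases h' : t'.root = 0
      · rw [h, h']
      · exact (root_eq_of_mark_eq hidx.symm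
          (fun γ hγ => (hm γ (hidx ▸ hγ)).symm) h').symm
    · exact root_eq_of_mark_eq hidx hm h
  have key : ∀ γ ∈ t.idx.1, t.root ≤ γ → t.cod = t'.cod ∧ t.g γ = t'.g γ ∧ t.h γ = t'.h γ := by
    intro γ hγ hr
    have := hm γ hγ
    rw [mark_of_le _ hr, mark_of_le _ (hroot ▸ hr)] at this
    simpa using this
  have hcod : t.cod = t'.cod := by
    rcases t.root_spec with h | ⟨-, -, γ₁, hγ₁, h₁⟩
    · obtain ⟨γ, hγ⟩ := hne
      exact (key γ hγ (by simp [h])).1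
    · exact (key γ₁ hγ₁ h₁).1
  refine Letter.ext hidx hcod hroot (funext fun γ => ?_) (funext fun γ => ?_)
  · by_cases h : γ ∈ t.idx.1 ∧ t.root ≤ γ
    · exact (key γ h.1 h.2).2.1
    · rw [t.g_eq_zero γ h, t'.g_eq_zero γ (by rwa [← hidx, ← hroot])]
  · by_cases h : γ ∈ t.idx.1 ∧ t.root ≤ γ
    · exact (key γ h.1 h.2).2.2
    · rw [t.h_eq_zero γ h, t'.h_eq_zero γ (by rwa [← hidx, ← hroot])]

open Classical in
/-- The letter with root `0` that is the restriction of `g : β → α`. -/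
def pure (r : CountableSubsets lam) (α β : Ordinal.{u}) (g : Ordinal.{u} → Ordinal.{u})
    (hg : Grows lam alphaStar α β g) (hr : r.1 ⊆ Iio β) : Letter lam alphaStar where
  idx := r
  cod := α
  root := 0
  g γ := if γ ∈ r.1 then g γ else 0
  h γ := if γ ∈ r.1 then hOf β g γ else 0
  g_eq_zero _ h := if_neg fun h' => h ⟨h', zero_le⟩
  h_eq_zero _ h := if_neg fun h' => h ⟨h', zero_le⟩
  root_spec := Or.inl rfl
  exists_grows := ⟨β, g, hg, hr, fun _ hγ _ => ⟨if_pos hγ, if_pos hγ⟩⟩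

theorem pure_mark {r : CountableSubsets lam} {α β : Ordinal.{u}} {g : Ordinal.{u} → Ordinal.{u}}
    (hg : Grows lam alphaStar α β g) (hr : r.1 ⊆ Iio β) (hγ : γ ∈ r.1) :
    (pure r α β g hg hr).mark γ = ⟨α, g γ, hOf β g γ⟩ := by
  rw [mark_of_le _ zero_le]
  simp [pure, hγ]

end Letter

section

variable {lam : Cardinal.{u}} {alphaStar : Ordinal.{u}}

theorem grows_const (h1 : 1 < alphaStar) {δ : Ordinal.{u}} (hδ : δ < lam.ord) :
    Grows lam alphaStar 1 δ (fun _ => 0) where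
  cod_lt := h1
  dom_lt := hδ
  mapsTo _ _ := mem_Iio.2 zero_lt_one
  monotoneOn _ _ _ _ _ := le_rfl

/-- Every thread restricts to a letter at each countable subset of its domain. -/
theorem exists_letter {δ α β : Ordinal.{u}} {g : Ordinal.{u} → Ordinal.{u}}
    (hg : Grows lam alphaStar α β g) (hδ : δ < lam.ord) (h1 : 0 < δ → 1 < alphaStar)
    (r : CountableSubsets lam) (hr : r.1 ⊆ Iio β) :
    ∃ t : Letter lam alphaStar, t.idx = r ∧ (∀ γ ∈ r.1, t.mark γ = thread δ α β g γ) ∧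
      (0 < δ → r.1 ⊆ Iio δ → t.cod = 1) := by
  classical
  by_cases ha : 0 < δ ∧ r.1 ⊆ Iio δ
  · refine ⟨.pure r 1 δ _ (grows_const (h1 ha.1) hδ) ha.2, rfl, fun γ hγ => ?_, fun _ _ => rfl⟩
    rw [Letter.pure_mark _ _ hγ, thread_of_lt (ha.2 hγ), hOf_const]
  by_cases hb : ∃ γ ∈ r.1, γ < δ
  · obtain ⟨γ₀, hγ₀, h₀⟩ := hb
    have hδ0 : 0 < δ := zero_le.trans_lt h₀
    have hc : ∃ γ ∈ r.1, δ ≤ γ := by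
      by_contra! hc
      exact ha ⟨hδ0, hc⟩
    refine ⟨{ idx := r, cod := α, root := δ
              g := fun γ => if γ ∈ r.1 ∧ δ ≤ γ then g γ else 0
              h := fun γ => if γ ∈ r.1 ∧ δ ≤ γ then hOf β g γ else 0
              g_eq_zero := fun _ h => if_neg h
              h_eq_zero := fun _ h => if_neg h
              root_spec := Or.inr ⟨h1 hδ0, ⟨γ₀, hγ₀, h₀⟩, hc⟩
              exists_grows := ⟨β, g, hg, hr, fun γ h h' =>
                ⟨if_pos ⟨h, h'⟩, if_pos ⟨h, h'⟩⟩⟩ }, rfl, fun γ hγ => ?_,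
            fun h h' => (ha ⟨h, h'⟩).elim⟩
    rcases lt_or_ge γ δ with h | h
    · rw [thread_of_lt h, Letter.mark_of_lt _ h]
    · rw [thread_of_le h, Letter.mark_of_le _ h]
      simp [hγ, h]
  · push Not at hb
    refine ⟨.pure r α β g hg hr, rfl, fun γ hγ => ?_, fun h h' => (ha ⟨h, h'⟩).elim⟩
    rw [Letter.pure_mark _ _ hγ, thread_of_le (hb γ hγ)]

/-- Letters restrict to subsets of their index.  A letter that is cut off at its root has codomain
`1`. -/
theorem Letter.exists_restrict (hlam : ℵ₀ ≤ lam) (t : Letter lam alphaStar)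
    (r : CountableSubsets lam) (hr : r.1 ⊆ t.idx.1) :
    ∃ t₀ : Letter lam alphaStar, t₀.idx = r ∧ ∀ γ ∈ r.1, t₀.mark γ = t.mark γ := by
  obtain ⟨β, g, hg, hβ, h⟩ := t.exists_thread
  have h1 : 0 < t.root → 1 < alphaStar := fun h0 => by
    rcases t.root_spec with h' | h'
    · simp [h'] at h0
    · exact h'.1
  obtain ⟨t₀, h₀, h₂, -⟩ := exists_letter hg (t.root_lt hlam) h1 r (hr.trans hβ)
  exact ⟨t₀, h₀, fun γ hγ => by rw [h₂ γ hγ, h γ (hr hγ)]⟩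

end

/-! ### The parameter -/

section Param

variable {lam : Cardinal.{u}} {alphaStar : Ordinal.{u}}

namespace Letter

variable (t : Letter lam alphaStar) {γ : Ordinal.{u}}

open Classical in
/-- The function `h_t` of the full parameter.  For a letter with a root `d ≠ 0`, it is `0` below `d`
and codes the pair of `d` and `h γ` above. -/
def codeH (γ : Ordinal.{u}) : Ordinal.{u} :=
  if t.root = 0 then t.h γ else if γ < t.root then 0 else t.h γ * t.h γ + t.root

theorem codeH_of_root_eq (h : t.root = 0) : t.codeH = t.h := by
  funext γ; simp [codeH, h]

theorem codeH_of_lt (h : γ < t.root) : t.codeH γ = 0 := by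
  have : t.root ≠ 0 := (zero_le.trans_lt h).ne'
  simp [codeH, h, this]

theorem codeH_of_le (h0 : t.root ≠ 0) (h : t.root ≤ γ) :
    t.codeH γ = t.h γ * t.h γ + t.root := by
  simp [codeH, h0, h.not_gt]

theorem codeH_eq_zero_iff (hγ : γ ∈ t.idx.1) : t.codeH γ = 0 ↔ γ < t.root := by
  refine ⟨fun h => ?_, t.codeH_of_lt⟩
  by_contra! h'
  by_cases h0 : t.root = 0
  · rw [t.codeH_of_root_eq h0] at h
    exact (zero_le.trans_lt (t.lt_h hγ h')).ne' h
  · rw [t.codeH_of_le h0 h', Ordinal.add_eq_zero_iff] at h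
    exact h0 h.2

theorem codeH_lt (hlam : ℵ₀ ≤ lam) (hγ : γ ∈ t.idx.1) : t.codeH γ < lam.ord := by
  have h0 : 0 < lam.ord := ord_pos.2 (aleph0_pos.trans_le hlam)
  rcases lt_or_ge γ t.root with h | h
  · rwa [t.codeH_of_lt h]
  by_cases hr : t.root = 0
  · rw [t.codeH_of_root_eq hr]; exact t.h_lt hγ h
  · rw [t.codeH_of_le hr h]
    exact isPrincipal_add_ord hlam (isPrincipal_mul_ord hlam (t.h_lt hγ h) (t.h_lt hγ h))
      (t.root_lt hlam)

theorem codeH_monotoneOn : MonotoneOn t.codeH t.idx.1 := by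
  intro γ hγ γ' hγ' hle
  rcases lt_or_ge γ t.root with h | h
  · rw [t.codeH_of_lt h]; exact zero_le
  have hh := t.h_mono hγ hγ' h hle
  by_cases hr : t.root = 0
  · rwa [t.codeH_of_root_eq hr]
  · rw [t.codeH_of_le hr h, t.codeH_of_le hr (h.trans hle)]
    gcongr

end Letter

/-- Pairs of ordinals `b < a` are coded by `a * a + b`. -/
theorem square_add_injective {a b c d : Ordinal.{u}} (hb : b < a) (hd : d < c)
    (h : a * a + b = c * c + d) : a = c ∧ b = d := by
  have key : ∀ {a b c d : Ordinal.{u}}, b < a → a < c → a * a + b < c * c + d := by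
    intro a b c d hb hac
    calc a * a + b < a * a + a := by gcongr
      _ = a * (a + 1) := by rw [mul_add_one]
      _ ≤ c * c := by
        gcongr
        exact Order.add_one_le_of_lt hac
      _ ≤ c * c + d := le_self_add
  rcases lt_trichotomy a c with hac | rfl | hac
  · exact ((key hb hac).ne h).elim
  · exact ⟨rfl, by simpa using h⟩
  · exact ((key hd hac).ne' h).elim

/-- A letter is determined by the data of the full parameter.  Points below the root are recognized
by the value `0` of `codeH`, which is positive elsewhere. -/
theorem Letter.eq_of_code_eq (t t' : Letter lam alphaStar) (hidx : t.idx = t'.idx)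
    (hcod : t.cod = t'.cod) (hg : EqOn t.g t'.g t.idx.1) (hh : EqOn t.codeH t'.codeH t.idx.1) :
    t = t' := by
  have hlt : ∀ γ ∈ t.idx.1, γ < t.root ↔ γ < t'.root := fun γ hγ => by
    rw [← t.codeH_eq_zero_iff hγ, ← t'.codeH_eq_zero_iff (hidx ▸ hγ), hh hγ]
  have hr0 : t.root = 0 ↔ t'.root = 0 := by
    constructor <;> intro h
    · by_contra h'
      rcases t'.root_spec with h'' | ⟨-, ⟨γ, hγ, hγr⟩, -⟩
      · exact h' h''
      · rw [← hidx] at hγ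
        have := (hlt γ hγ).2 hγr
        simp [h] at this
    · by_contra h'
      rcases t.root_spec with h'' | ⟨-, ⟨γ, hγ, hγr⟩, -⟩
      · exact h' h''
      · have := (hlt γ hγ).1 hγr
        simp [h] at this
  have key : ∀ γ ∈ t.idx.1, t.root ≤ γ → t.h γ = t'.h γ ∧ t.root = t'.root := by
    intro γ hγ hr
    have hr' : t'.root ≤ γ := not_lt.1 fun h' => hr.not_gt ((hlt γ hγ).2 h')
    have := hh hγ
    by_cases h0 : t.root = 0
    · rw [t.codeH_of_root_eq h0, t'.codeH_of_root_eq (hr0.1 h0)] at this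
      exact ⟨this, by rw [h0, hr0.1 h0]⟩
    · rw [t.codeH_of_le h0 hr, t'.codeH_of_le (fun h => h0 (hr0.2 h)) hr'] at this
      exact square_add_injective (hr.trans_lt (t.lt_h hγ hr))
        (hr'.trans_lt (t'.lt_h (hidx ▸ hγ) hr')) this
  have hroot : t.root = t'.root := by
    rcases t.root_spec with h | ⟨-, -, γ, hγ, hr⟩
    · rw [h, hr0.1 h]
    · exact (key γ hγ hr).2
  refine Letter.ext hidx hcod hroot (funext fun γ => ?_) (funext fun γ => ?_)
  · by_cases h : γ ∈ t.idx.1 ∧ t.root ≤ γ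
    · exact hg h.1
    · rw [t.g_eq_zero γ h, t'.g_eq_zero γ (by rwa [← hidx, ← hroot])]
  · by_cases h : γ ∈ t.idx.1 ∧ t.root ≤ γ
    · exact (key γ h.1 h.2).1
    · rw [t.h_eq_zero γ h, t'.h_eq_zero γ (by rwa [← hidx, ← hroot])]

/-- The full parameter whose indices are the countable subsets of `lam`, with the restriction maps
between letters as `T`.  A nonempty index is related to all larger indices.  The empty index is
related to `{0}` only: letters at larger indices may have a root, and then restrict to letters with
different codomains, so that no restriction to `∅` is compatible with all restriction maps. -/
def rootedParameter (hlam : ℵ₀ ≤ lam) (hle : alphaStar ≤ lam.ord) :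
    FullParameter lam (CountableSubsets lam) (Letter lam alphaStar) where
  alphaStar := alphaStar
  alphaStar_le := hle
  S := {p | p.1.1 ⊆ p.2.1 ∧ (p.1.1 = ∅ → p.2.1 = {0})}
  u r := r.1
  u_subset r := r.2.1
  s t := t.idx
  T := {p | (p.1.idx.1 ⊆ p.2.idx.1 ∧ (p.1.idx.1 = ∅ → p.2.idx.1 = {0})) ∧
    (p.1.idx.1 = ∅ → p.1.cod = p.2.cod) ∧ ∀ γ ∈ p.1.idx.1, p.1.mark γ = p.2.mark γ}
  T_subset _ _ h := h.1
  alpha t := t.cod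
  alpha_lt t := t.cod_lt
  g t := t.g
  g_mapsTo t γ hγ := by
    rcases lt_or_ge γ t.root with h | h
    · rw [t.g_eq_zero γ fun h' => h.not_ge h'.2]
      rcases t.root_spec with h' | ⟨-, -, γ₁, hγ₁, h₁⟩
      · simp [h'] at h
      · exact zero_le.trans_lt (t.g_lt hγ₁ h₁)
    · exact t.g_lt hγ h
  h t := t.codeH
  h_mapsTo t _ hγ := t.codeH_lt hlam hγ
  h_monotoneOn t := t.codeH_monotoneOn
  eq_of_eq t₁ t₂ := t₁.eq_of_code_eq t₂

end Param

/-! ### Letters of words in free groups -/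

section FreeGroupLetters

variable {X Y : Type*}

open Classical in
/-- The set of generators that occur in the reduced word of an element of a free group. -/
def wordLetters (w : FreeGroup X) : Set X := {a | ∃ b, (a, b) ∈ w.toWord}

theorem wordLetters_finite (w : FreeGroup X) : (wordLetters w).Finite := by
  classical
  refine (List.finite_toSet (w.toWord.map Prod.fst)).subset ?_
  rintro a ⟨b, hb⟩
  exact List.mem_map.2 ⟨(a, b), hb, rfl⟩

theorem wordLetters_nonempty {w : FreeGroup X} (hw : w ≠ 1) : (wordLetters w).Nonempty := by
  classical
  obtain ⟨p, hp⟩ := List.exists_mem_of_ne_nil _ (mt FreeGroup.toWord_eq_nil_iff.1 hw)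
  exact ⟨p.1, p.2, hp⟩

theorem wordLetters_of (a : X) : wordLetters (FreeGroup.of a) = {a} := by
  classical
  ext x
  simp [wordLetters, FreeGroup.toWord_of]

theorem toWord_map [DecidableEq X] [DecidableEq Y] (f : X → Y) (w : FreeGroup X) :
    (FreeGroup.map f w).toWord = FreeGroup.reduce (w.toWord.map fun p => (f p.1, p.2)) := by
  conv_lhs => rw [← FreeGroup.mk_toWord (x := w), FreeGroup.map.mk, FreeGroup.toWord_mk]

theorem wordLetters_map_subset (f : X → Y) (w : FreeGroup X) :
    wordLetters (FreeGroup.map f w) ⊆ f '' wordLetters w := by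
  classical
  rintro y ⟨b, hb⟩
  rw [show (FreeGroup.map f w).toWord = _ by convert toWord_map f w] at hb
  have := (FreeGroup.reduce.red (L := w.toWord.map fun p => (f p.1, p.2))).sublist.subset
    (by convert hb)
  obtain ⟨p, hp, h⟩ := List.mem_map.1 this
  refine ⟨p.1, ⟨p.2, by convert hp⟩, ?_⟩
  simpa using congrArg Prod.fst h

theorem wordLetters_map_of_injOn {f : X → Y} {w : FreeGroup X} (hf : InjOn f (wordLetters w)) :
    wordLetters (FreeGroup.map f w) = f '' wordLetters w := by
  classical
  refine (wordLetters_map_subset f w).antisymm ?_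
  have hred : FreeGroup.IsReduced (w.toWord.map fun p => (f p.1, p.2)) := by
    have h0 : FreeGroup.IsReduced w.toWord := FreeGroup.isReduced_toWord
    unfold FreeGroup.IsReduced at h0 ⊢
    rw [List.isChain_map]
    refine h0.imp_of_mem_imp fun p q hp hq h he => ?_
    exact h (hf ⟨_, hp⟩ ⟨_, hq⟩ he)
  rintro _ ⟨x, ⟨b, hb⟩, rfl⟩
  refine ⟨b, ?_⟩
  have e := toWord_map f w
  rw [hred.reduce_eq] at e
  have : (f x, b) ∈ (FreeGroup.map f w).toWord := by
    rw [e]; exact List.mem_map.2 ⟨(x, b), hb, rfl⟩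
  convert this

end FreeGroupLetters

namespace Parameter

variable {lam : Cardinal.{u}} {I : Type v} {J : Type w} (x : Parameter lam I J)

/-- If `T` is the graph of a function `f` between the generators, then `𝔾_{s₁,s₂}` is the graph of
the induced homomorphism. -/
theorem mem_G₂_iff_of_graph {s₁ s₂ : I} (f : {t : J // x.s t = s₂} → {t : J // x.s t = s₁})
    (hf : ∀ t₁ t₂, (t₁.1, t₂.1) ∈ x.T ↔ t₁ = f t₂) (y₁ : x.G s₁) (y₂ : x.G s₂) :
    (y₁, y₂) ∈ x.G₂ s₁ s₂ ↔ y₁ = FreeGroup.map f y₂ := by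
  constructor
  · intro h
    have : x.G₂ s₁ s₂ ≤ MonoidHom.eqLocus (MonoidHom.fst (x.G s₁) (x.G s₂))
        ((FreeGroup.map f).comp (MonoidHom.snd (x.G s₁) (x.G s₂))) := by
      rw [G₂, Subgroup.closure_le]
      rintro p ⟨t₁, t₂, hT, rfl⟩
      change FreeGroup.of t₁ = FreeGroup.map f (FreeGroup.of t₂)
      rw [FreeGroup.map.of, (hf t₁ t₂).1 hT]
    exact this h
  · rintro rfl
    have : (⊤ : Subgroup (x.G s₂)) ≤
        (x.G₂ s₁ s₂).comap ((FreeGroup.map f).prod (MonoidHom.id _)) := by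
      rw [← FreeGroup.closure_range_of, Subgroup.closure_le]
      rintro _ ⟨t, rfl⟩
      refine Subgroup.subset_closure ⟨f t, t, (hf _ _).2 rfl, ?_⟩
      simp
    exact this (Subgroup.mem_top y₂)

end Parameter

/-! ### Restriction maps of the parameter -/

section Restriction

variable {lam : Cardinal.{u}} {alphaStar : Ordinal.{u}} (hlam : ℵ₀ ≤ lam)
  (hle : alphaStar ≤ lam.ord)

local notation "𝔭" => rootedParameter hlam hle

/-- Over a nonempty index, `T` is the graph of the restriction map. -/
theorem exists_T_iff_of_nonempty {r₀ r : CountableSubsets lam} (hr : r₀.1 ⊆ r.1)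
    (hne : r₀.1.Nonempty) :
    ∃ f : {t // (𝔭).s t = r} → {t // (𝔭).s t = r₀},
      (∀ t, ∀ γ ∈ r₀.1, (f t).1.mark γ = t.1.mark γ) ∧
      ∀ t₀ t, (t₀.1, t.1) ∈ (𝔭).T ↔ t₀ = f t := by
  have h : ∀ t : {t // (𝔭).s t = r}, ∃ t₀ : {t // (𝔭).s t = r₀},
      ∀ γ ∈ r₀.1, t₀.1.mark γ = t.1.mark γ := by
    rintro ⟨t, rfl⟩
    obtain ⟨t₀, h₀, h⟩ := t.exists_restrict hlam r₀ hr
    exact ⟨⟨t₀, h₀⟩, h⟩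
  choose f hf using h
  refine ⟨f, hf, fun t₀ t => ⟨fun hT => ?_, ?_⟩⟩
  · obtain ⟨t₀, rfl⟩ := t₀
    apply Subtype.ext
    refine t₀.eq_of_mark_eq (f t).2.symm hne fun γ hγ => ?_
    rw [hf t γ hγ]
    exact hT.2.2 γ hγ
  · rintro rfl
    have h1 : (f t).1.idx = r₀ := (f t).2
    have h2 : t.1.idx = r := t.2
    refine ⟨⟨by simpa only [h1, h2] using hr, fun h => ?_⟩, fun h => ?_, fun γ hγ => ?_⟩
    · exact (hne.ne_empty (by simpa only [h1] using h)).elim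
    · exact (hne.ne_empty (by simpa only [h1] using h)).elim
    · exact hf t γ (by simpa only [h1] using hγ)

theorem Letter.grows_empty (hlam : ℵ₀ ≤ lam) {a : Ordinal.{u}} (ha : a < alphaStar) :
    Grows lam alphaStar a 0 (fun _ => 0) where
  cod_lt := ha
  dom_lt := ord_pos.2 (aleph0_pos.trans_le hlam)
  mapsTo _ h := (not_lt_zero (mem_Iio.1 h)).elim
  monotoneOn _ _ _ _ _ := le_rfl

/-- A letter with empty index is determined by its codomain. -/
theorem Letter.eq_of_empty (t t' : Letter lam alphaStar) (hidx : t.idx = t'.idx)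
    (he : t.idx.1 = ∅) (hcod : t.cod = t'.cod) : t = t' :=
  t.eq_of_code_eq t' hidx hcod (by rw [he]; exact eqOn_empty _ _) (by rw [he]; exact eqOn_empty _ _)

/-- Between the indices `∅` and `{0}`, `T` is the graph of the map that keeps the codomain. -/
theorem exists_T_iff_of_empty {r₀ r : CountableSubsets lam} (h₀ : r₀.1 = ∅) (hr : r.1 = {0}) :
    ∃ f : {t // (𝔭).s t = r} → {t // (𝔭).s t = r₀},
      ∀ t₀ t, (t₀.1, t.1) ∈ (𝔭).T ↔ t₀ = f t := by
  have h : ∀ t : {t // (𝔭).s t = r}, ∃ t₀ : {t // (𝔭).s t = r₀}, t₀.1.cod = t.1.cod :=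
    fun t => ⟨⟨.pure r₀ t.1.cod 0 _ (Letter.grows_empty hlam t.1.cod_lt) (by simp [h₀]), rfl⟩, rfl⟩
  choose f hf using h
  refine ⟨f, fun t₀ t => ⟨fun hT => ?_, ?_⟩⟩
  · obtain ⟨t₀, rfl⟩ := t₀
    apply Subtype.ext
    refine t₀.eq_of_empty _ (f t).2.symm h₀ ?_
    rw [hf t]
    exact hT.2.1 h₀
  · rintro rfl
    have h1 : (f t).1.idx = r₀ := (f t).2
    have h2 : t.1.idx = r := t.2
    refine ⟨⟨?_, fun _ => ?_⟩, fun h => hf t, fun γ hγ => ?_⟩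
    · simp only [h1, h₀, empty_subset]
    · rw [h2, hr]
    · simp only [h1, h₀, mem_empty_iff_false] at hγ

/-- The sets of letters `L r` (for `r` in a class `D` of indices) that occur in a family of elements
of the groups `𝔾_r`, as far as their behaviour under restriction is concerned: a letter at a smaller
index comes from one at a larger index, and letters can only disappear by cancellation, hence not
where restriction is injective. -/
structure IsLetterSystem (D : Set (Set Ordinal.{u}))
    (L : Set Ordinal.{u} → Set (Letter lam alphaStar)) : Prop where
  finite : ∀ r ∈ D, (L r).Finite
  idx_eq : ∀ r ∈ D, ∀ t ∈ L r, t.idx.1 = r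
  exists_extension : ∀ r₀ ∈ D, ∀ r ∈ D, r₀ ⊆ r → r₀.Nonempty → ∀ t₀ ∈ L r₀,
    ∃ t ∈ L r, EqOn t.mark t₀.mark r₀
  exists_restriction : ∀ r₀ ∈ D, ∀ r ∈ D, r₀ ⊆ r → r₀.Nonempty →
    (∀ t ∈ L r, ∀ t' ∈ L r, EqOn t.mark t'.mark r₀ → t = t') →
    ∀ t ∈ L r, ∃ t₀ ∈ L r₀, EqOn t₀.mark t.mark r₀

theorem IsLetterSystem.mono {D D' : Set (Set Ordinal.{u})}
    {L : Set Ordinal.{u} → Set (Letter lam alphaStar)} (h : IsLetterSystem D' L) (hD : D ⊆ D') :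
    IsLetterSystem D L where
  finite r hr := h.finite r (hD hr)
  idx_eq r hr := h.idx_eq r (hD hr)
  exists_extension r₀ h₀ r hr := h.exists_extension r₀ (hD h₀) r (hD hr)
  exists_restriction r₀ h₀ r hr := h.exists_restriction r₀ (hD h₀) r (hD hr)

/-- The letters of the elements `c ∈ 𝔾_r` with `E r c`. -/
def lettersOf (E : ∀ r, (𝔭).G r → Prop) (X : Set Ordinal.{u}) : Set (Letter lam alphaStar) :=
  {t | ∃ r, r.1 = X ∧ ∃ c, E r c ∧ ∃ a ∈ wordLetters c, a.1 = t}

theorem lettersOf_eq {E : ∀ r, (𝔭).G r → Prop} (huniq : ∀ r c c', E r c → E r c' → c = c')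
    {r : CountableSubsets lam} {c : (𝔭).G r} (hc : E r c) :
    lettersOf hlam hle E r.1 = Subtype.val '' wordLetters c := by
  ext t
  constructor
  · rintro ⟨r', hr', c', hc', a, ha, rfl⟩
    obtain rfl : r' = r := Subtype.ext hr'
    obtain rfl := huniq _ _ _ hc hc'
    exact ⟨a, ha, rfl⟩
  · rintro ⟨a, ha, rfl⟩
    exact ⟨r, rfl, c, hc, a, ha, rfl⟩

theorem isLetterSystem_lettersOf {E : ∀ r, (𝔭).G r → Prop}
    (huniq : ∀ r c c', E r c → E r c' → c = c')
    (hcoh : ∀ r₀ r c₀ c, E r₀ c₀ → E r c → (r₀, r) ∈ (𝔭).S → (c₀, c) ∈ (𝔭).G₂ r₀ r) :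
    IsLetterSystem {X | ∃ r : CountableSubsets lam, r.1 = X ∧ ∃ c, E r c}
      (lettersOf hlam hle E) where
  finite := by
    rintro _ ⟨r, rfl, c, hc⟩
    rw [lettersOf_eq hlam hle huniq hc]
    exact (wordLetters_finite c).image _
  idx_eq := by
    rintro _ ⟨r, rfl, c, hc⟩ t ht
    rw [lettersOf_eq hlam hle huniq hc] at ht
    obtain ⟨a, -, rfl⟩ := ht
    exact congrArg Subtype.val a.2
  exists_extension := by
    rintro _ ⟨r₀, rfl, c₀, hc₀⟩ _ ⟨r, rfl, c, hc⟩ hsub hne t₀ ht₀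
    rw [lettersOf_eq hlam hle huniq hc₀] at ht₀
    rw [lettersOf_eq hlam hle huniq hc]
    obtain ⟨f, hf, hT⟩ := exists_T_iff_of_nonempty hlam hle hsub hne
    have h := hcoh r₀ r c₀ c hc₀ hc ⟨hsub, fun h => (hne.ne_empty h).elim⟩
    rw [(𝔭).mem_G₂_iff_of_graph f hT] at h
    obtain ⟨a₀, ha₀, rfl⟩ := ht₀
    rw [h] at ha₀
    obtain ⟨a, ha, rfl⟩ := wordLetters_map_subset _ _ ha₀
    exact ⟨a.1, ⟨a, ha, rfl⟩, fun γ hγ => (hf a γ hγ).symm⟩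
  exists_restriction := by
    rintro _ ⟨r₀, rfl, c₀, hc₀⟩ _ ⟨r, rfl, c, hc⟩ hsub hne hinj t ht
    rw [lettersOf_eq hlam hle huniq hc] at ht hinj
    rw [lettersOf_eq hlam hle huniq hc₀]
    obtain ⟨f, hf, hT⟩ := exists_T_iff_of_nonempty hlam hle hsub hne
    have h := hcoh r₀ r c₀ c hc₀ hc ⟨hsub, fun h => (hne.ne_empty h).elim⟩
    rw [(𝔭).mem_G₂_iff_of_graph f hT] at h
    obtain ⟨a, ha, rfl⟩ := ht
    have hinj' : InjOn f (wordLetters c) := by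
      intro a ha b hb hab
      refine Subtype.ext (hinj _ ⟨a, ha, rfl⟩ _ ⟨b, hb, rfl⟩ fun γ hγ => ?_)
      rw [← hf a γ hγ, ← hf b γ hγ, hab]
    refine ⟨(f a).1, ⟨f a, ?_, rfl⟩, fun γ hγ => hf a γ hγ⟩
    rw [h, wordLetters_map_of_injOn hinj']
    exact ⟨a, ha, rfl⟩

end Restriction

/-! ### Rigidity -/

section Bounds

variable {lam : Cardinal.{u}}

theorem exists_bound (hreg : lam.IsRegular) {s : Set Ordinal.{u}}
    (hs : #s < Cardinal.lift.{u + 1} lam) (h : ∀ γ ∈ s, γ < lam.ord) :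
    ∃ b < lam.ord, ∀ γ ∈ s, γ < b := by
  refine ⟨sSup ((· + 1) '' s), sSup_add_one_lt_of_lt_cof ?_ h, fun γ hγ => ?_⟩
  · rwa [← lift_cof, hreg.cof_ord]
  · refine (Order.lt_add_one_iff.2 le_rfl).trans_le (le_csSup ⟨lam.ord, ?_⟩ ⟨γ, hγ, rfl⟩)
    rintro _ ⟨γ', hγ', rfl⟩
    exact Order.add_one_le_of_lt (h γ' hγ')

theorem mk_lt_lift_of_countable (hunc : ℵ₀ < lam) {X : Type (u + 1)} {s : Set X}
    (hs : s.Countable) : #s < Cardinal.lift.{u + 1} lam :=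
  (le_aleph0_iff_set_countable.2 hs).trans_lt (by simpa using hunc)

theorem mk_Iio_lt_lift {a : Ordinal.{u}} (ha : a < lam.ord) :
    #(Iio a) < Cardinal.lift.{u + 1} lam := by
  rw [Cardinal.mk_Iio_ordinal, Cardinal.lift_lt]
  exact lt_ord.1 ha

end Bounds

section LetterSystem

variable {lam : Cardinal.{u}} {alphaStar : Ordinal.{u}} {D : Set (Set Ordinal.{u})}
  {L : Set Ordinal.{u} → Set (Letter lam alphaStar)}

theorem Letter.eq_of_eqOn {t t' : Letter lam alphaStar} {r : Set Ordinal.{u}} (h : t.idx.1 = r)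
    (h' : t'.idx.1 = r) (hne : r.Nonempty) (hm : EqOn t.mark t'.mark r) : t = t' := by
  subst h
  exact t.eq_of_mark_eq (Subtype.ext h'.symm) hne hm

/-- There is no thread through all of `lam`: its values would be bounded by some `a < lam`, but they
increase whenever one of their bounds is passed, and by regularity the bounds met at the at most `a`
values are bounded below `lam`. -/
theorem not_exists_long_thread (hreg : lam.IsRegular) {a δ : Ordinal.{u}} (ha : a < lam.ord)
    (hδ : δ < lam.ord) (val bound : Ordinal.{u} → Ordinal.{u})
    (hval : ∀ γ, δ ≤ γ → γ < lam.ord → val γ < a)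
    (hbound : ∀ γ, δ ≤ γ → γ < lam.ord → bound γ < lam.ord)
    (hlt : ∀ γ γ', δ ≤ γ → γ < lam.ord → δ ≤ γ' → γ' < lam.ord → bound γ ≤ γ' → val γ < val γ') :
    False := by
  have h : ∀ v, ∃ γ, δ ≤ γ ∧ γ < lam.ord ∧
      ((∃ γ', δ ≤ γ' ∧ γ' < lam.ord ∧ val γ' = v) → val γ = v) := by
    intro v
    by_cases hv : ∃ γ', δ ≤ γ' ∧ γ' < lam.ord ∧ val γ' = v
    · obtain ⟨γ, h1, h2, h3⟩ := hv
      exact ⟨γ, h1, h2, fun _ => h3⟩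
    · exact ⟨δ, le_rfl, hδ, fun h => (hv h).elim⟩
  choose p hp1 hp2 hp3 using h
  obtain ⟨b, hb, hlb⟩ := exists_bound hreg (s := (fun v => bound (p v)) '' Iio a)
    (mk_image_le.trans_lt (mk_Iio_lt_lift ha)) (by
      rintro _ ⟨v, -, rfl⟩
      exact hbound _ (hp1 v) (hp2 v))
  have hm : max b δ < lam.ord := max_lt hb hδ
  have hd : δ ≤ max b δ := le_max_right _ _
  have h1 := hlt (p (val (max b δ))) (max b δ) (hp1 _) (hp2 _) hd hm
    ((hlb _ ⟨_, hval _ hd hm, rfl⟩).le.trans (le_max_left _ _))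
  rw [hp3 _ ⟨_, hd, hm, rfl⟩] at h1
  exact lt_irrefl _ h1

theorem IsLetterSystem.ncard_le (hL : IsLetterSystem D L) {r₀ r : Set Ordinal.{u}} (h₀ : r₀ ∈ D)
    (h : r ∈ D) (hsub : r₀ ⊆ r) (hne : r₀.Nonempty) : (L r₀).ncard ≤ (L r).ncard := by
  choose! e he hm using hL.exists_extension r₀ h₀ r h hsub hne
  refine ncard_le_ncard_of_injOn e he (fun t ht t' ht' hee => ?_) (hL.finite r h)
  refine Letter.eq_of_eqOn (hL.idx_eq _ h₀ _ ht) (hL.idx_eq _ h₀ _ ht') hne fun γ hγ => ?_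
  rw [← hm t ht hγ, ← hm t' ht' hγ, hee]

/-- If there are no more letters at `r` than at `r₀`, then letters at `r₀` have only one extension
to `r`. -/
theorem IsLetterSystem.eq_of_ncard_le (hL : IsLetterSystem D L) {r₀ r : Set Ordinal.{u}}
    (h₀ : r₀ ∈ D) (h : r ∈ D) (hsub : r₀ ⊆ r) (hne : r₀.Nonempty) (hc : (L r).ncard ≤ (L r₀).ncard)
    {t t' : Letter lam alphaStar} (ht : t ∈ L r) (ht' : t' ∈ L r) (hm : EqOn t.mark t'.mark r₀) :
    t = t' := by
  choose! e he hme using hL.exists_extension r₀ h₀ r h hsub hne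
  have key : ∀ t ∈ L r₀, ∀ t' ∈ L r₀, EqOn (e t).mark (e t').mark r₀ → t = t' := by
    intro t ht t' ht' hh
    refine Letter.eq_of_eqOn (hL.idx_eq _ h₀ _ ht) (hL.idx_eq _ h₀ _ ht') hne fun γ hγ => ?_
    rw [← hme t ht hγ, ← hme t' ht' hγ, hh hγ]
  have hinj : InjOn e (L r₀) := fun t ht t' ht' hee =>
    key t ht t' ht' (by rw [hee]; exact eqOn_refl _ _)
  have himg : e '' L r₀ = L r := eq_of_subset_of_ncard_le (image_subset_iff.2 he)
    (by rwa [hinj.ncard_image]) (hL.finite r h)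
  rw [← himg] at ht ht'
  obtain ⟨t₁, h₁, rfl⟩ := ht
  obtain ⟨t₂, h₂, rfl⟩ := ht'
  rw [key t₁ h₁ t₂ h₂ hm]

/-- A letter system on all countable sets is trivial.  The number of letters is monotone, and
bounded since countably many countable sets have a countable union; from an index where it is
maximal on, letters extend uniquely, and so define a thread through all of `lam`. -/
theorem IsLetterSystem.eq_empty (hreg : lam.IsRegular) (hle : alphaStar ≤ lam.ord)
    (hL : IsLetterSystem D L)
    (hD : ∀ r : Set Ordinal.{u}, r ⊆ Iio lam.ord → r.Countable → r ∈ D)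
    (hD' : ∀ r ∈ D, r ⊆ Iio lam.ord ∧ r.Countable)
    {r₀ : Set Ordinal.{u}} (h₀ : r₀ ∈ D) (hne : r₀.Nonempty) : L r₀ = ∅ := by
  by_contra hL₀
  obtain ⟨t₀, ht₀⟩ := nonempty_iff_ne_empty.2 hL₀
  set K : Set ℕ := {n | ∃ r ∈ D, r₀ ⊆ r ∧ (L r).ncard = n} with hK
  have hbdd : BddAbove K := by
    by_contra hb
    rw [not_bddAbove_iff] at hb
    choose n hn hn' using hb
    choose R hR hR₀ hRn using hn
    have hU : (⋃ k, R k) ∈ D := hD _ (iUnion_subset fun k => (hD' _ (hR k)).1)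
      (countable_iUnion fun k => (hD' _ (hR k)).2)
    have h1 := hn' (L (⋃ k, R k)).ncard
    rw [← hRn] at h1
    exact h1.not_ge (hL.ncard_le (hR _) hU (subset_iUnion R _) (hne.mono (hR₀ _)))
  obtain ⟨r₁, h₁, hr₁, hn₁⟩ := Nat.sSup_mem (s := K) ⟨_, r₀, h₀, Subset.rfl, rfl⟩ hbdd
  have hne₁ : r₁.Nonempty := hne.mono hr₁
  have hmax : ∀ r ∈ D, r₁ ⊆ r → (L r).ncard ≤ (L r₁).ncard := fun r hr hs => by
    rw [hn₁]
    exact le_csSup hbdd ⟨r, hr, hr₁.trans hs, rfl⟩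
  have huniq : ∀ r ∈ D, r₁ ⊆ r → ∀ t ∈ L r, ∀ t' ∈ L r, EqOn t.mark t'.mark r₁ → t = t' :=
    fun r hr hs t ht t' ht' hm => hL.eq_of_ncard_le h₁ hr hs hne₁ (hmax r hr hs) ht ht' hm
  obtain ⟨t₁, ht₁, -⟩ := hL.exists_extension _ h₀ _ h₁ hr₁ hne t₀ ht₀
  have : Nonempty (Letter lam alphaStar) := ⟨t₁⟩
  choose! τ hτ hτm using fun r (hr : r ∈ D) (hs : r₁ ⊆ r) =>
    hL.exists_extension r₁ h₁ r hr hs hne₁ t₁ ht₁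
  have hcoh : ∀ r ∈ D, ∀ r' ∈ D, r₁ ⊆ r → r ⊆ r' → EqOn (τ r).mark (τ r').mark r := by
    intro r hr r' hr' hs hs'
    obtain ⟨t, ht, hm⟩ := hL.exists_restriction r hr r' hr' hs' (hne₁.mono hs)
      (fun t ht t' ht' h => huniq r' hr' (hs.trans hs') t ht t' ht' (h.mono hs)) _
      (hτ r' hr' (hs.trans hs'))
    rw [huniq r hr hs _ (hτ r hr hs) t ht]
    · exact hm
    · intro γ hγ
      rw [hτm r hr hs hγ, hm (hs hγ), hτm r' hr' (hs.trans hs') hγ]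
  have hins : ∀ γ γ', γ < lam.ord → γ' < lam.ord → insert γ (insert γ' r₁) ∈ D := by
    intro γ γ' h h'
    exact hD _ (insert_subset h (insert_subset h' (hD' _ h₁).1)) (((hD' _ h₁).2.insert _).insert _)
  obtain ⟨γ₀, hγ₀⟩ := hne₁
  have hidx₁ := hL.idx_eq _ h₁ _ ht₁
  set δ := (t₁.mark γ₀).bound with hδdef
  have hδ : δ < lam.ord := t₁.mark_bound_lt hreg.1 (hidx₁.symm ▸ hγ₀)
  -- `τ` evaluated at any two points is the restriction of one letter
  have hpair : ∀ γ γ', γ < lam.ord → γ' < lam.ord → ∃ t : Letter lam alphaStar,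
      γ ∈ t.idx.1 ∧ γ' ∈ t.idx.1 ∧ γ₀ ∈ t.idx.1 ∧ (t.mark γ₀).bound = δ ∧
      t.mark γ = (τ (insert γ r₁)).mark γ ∧ t.mark γ' = (τ (insert γ' r₁)).mark γ' := by
    intro γ γ' h h'
    have hD2 := hins γ γ' h h'
    have hs2 : r₁ ⊆ insert γ (insert γ' r₁) := (subset_insert _ _).trans (subset_insert _ _)
    have hi := hL.idx_eq _ hD2 _ (hτ _ hD2 hs2)
    have hDγ : insert γ r₁ ∈ D := by simpa using hins γ γ h h
    have hDγ' : insert γ' r₁ ∈ D := by simpa using hins γ' γ' h' h'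
    refine ⟨τ (insert γ (insert γ' r₁)), ?_, ?_, ?_, ?_, ?_, ?_⟩
    · rw [hi]; simp
    · rw [hi]; simp
    · rw [hi]; exact hs2 hγ₀
    · rw [hτm _ hD2 hs2 hγ₀]
    · exact (hcoh _ hDγ _ hD2 (subset_insert _ _) (insert_subset_insert (subset_insert _ _))
        (mem_insert _ _)).symm
    · exact (hcoh _ hDγ' _ hD2 (subset_insert _ _) (subset_insert _ _) (mem_insert _ _)).symm
  set m : Ordinal.{u} → Mark.{u} := fun γ => (τ (insert γ r₁)).mark γ with hm
  refine not_exists_long_thread hreg (a := (m δ).cod) (δ := δ) ?_ hδ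
    (fun γ => (m γ).val) (fun γ => (m γ).bound) ?_ ?_ ?_
  · exact (Letter.mark_cod_lt _ _).trans_le hle
  · intro γ h h'
    obtain ⟨t, h1, h2, h3, h4, h5, h6⟩ := hpair γ δ h' hδ
    have := t.mark_val_lt_cod h1
    rw [t.mark_cod_of_bound_le h3 (h4.trans_le h), ← t.mark_cod_of_bound_le h3 h4.le, h5,
      h6] at this
    exact this
  · intro γ h h'
    obtain ⟨t, h1, h2, h3, h4, h5, h6⟩ := hpair γ δ h' hδ
    have := t.mark_bound_lt hreg.1 h1
    rwa [h5] at this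
  · intro γ γ' h h' h'' h''' hb
    obtain ⟨t, h1, h2, h3, h4, h5, h6⟩ := hpair γ γ' h' h'''
    have := t.mark_val_lt_val h3 h1 h2 (h4.trans_le h) (by rw [h5]; exact hb)
    rwa [h5, h6] at this

end LetterSystem

section Rigid

variable {lam : Cardinal.{u}} {alphaStar : Ordinal.{u}}

theorem condOne (hreg : lam.IsRegular) (hle : alphaStar ≤ lam.ord) (s : CountableSubsets lam) :
    (rootedParameter hreg.1 hle).CondOne Set.univ ⟨s, mem_univ s⟩ := by
  rintro ⟨c, hc, hs⟩
  let E : ∀ r, (rootedParameter hreg.1 hle).G r → Prop := fun r y => y = c ⟨r, mem_univ r⟩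
  have huniq : ∀ r y y', E r y → E r y' → y = y' := fun r y y' h h' => h.trans h'.symm
  have hsys := isLetterSystem_lettersOf hreg.1 hle (E := E) huniq
    (by rintro r₀ r _ _ rfl rfl hS; exact hc ⟨r₀, _⟩ ⟨r, _⟩ hS)
  have key : ∀ r : CountableSubsets lam, r.1.Nonempty → c ⟨r, mem_univ r⟩ = 1 := by
    intro r hr
    by_contra hne
    have h1 := hsys.eq_empty hreg hle (fun X h h' => ⟨⟨X, h, h'⟩, rfl, _, rfl⟩)
      (by rintro _ ⟨r, rfl, -⟩; exact r.2) ⟨r, rfl, _, rfl⟩ hr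
    rw [lettersOf_eq hreg.1 hle huniq (rfl : E r (c ⟨r, mem_univ r⟩))] at h1
    exact ((wordLetters_nonempty hne).image _).ne_empty h1
  rcases s.1.eq_empty_or_nonempty with h | h
  · let z : CountableSubsets lam :=
      ⟨{0}, by simpa using hreg.ord_pos, countable_singleton 0⟩
    obtain ⟨f, hf⟩ := exists_T_iff_of_empty hreg.1 hle (r₀ := s) (r := z) h rfl
    have h2 := hc ⟨s, mem_univ s⟩ ⟨z, mem_univ z⟩ ⟨by simp [h], fun _ => rfl⟩
    rw [Parameter.mem_G₂_iff_of_graph _ f hf, key z (singleton_nonempty 0), map_one] at h2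
    exact hs h2
  · exact hs (key s h)

namespace Parameter

variable {I : Type v} {J : Type w} (x : Parameter lam I J)

theorem F_self (s : I) (a y : x.G s) : x.F s a ⟨s, y⟩ = ⟨s, a * y⟩ :=
  dif_pos rfl

theorem F_of_ne {s r : I} (a : x.G s) (y : x.G r) (h : r ≠ s) : x.F s a ⟨r, y⟩ = ⟨r, y⟩ :=
  dif_neg h

theorem Q_mk {r₁ r₂ : I} (y₁ : x.G r₁) (y₂ : x.G r₂) :
    x.Q r₁ r₂ ⟨r₁, y₁⟩ ⟨r₂, y₂⟩ ↔ (y₁, y₂) ∈ x.G₂ r₁ r₂ := by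
  constructor
  · rintro ⟨y, z, h, h', hyz⟩
    have h1 := eq_of_heq (Sigma.mk.inj h).2
    have h2 := eq_of_heq (Sigma.mk.inj h').2
    rwa [h1, h2]
  · intro h
    exact ⟨y₁, y₂, rfl, rfl, h⟩

/-- Automorphisms act by right multiplication with a family as in `CondOne`. -/
theorem isRigidAt_of_condOne (h : ∀ s, x.CondOne Set.univ ⟨s, mem_univ s⟩) (s : I) :
    x.IsRigidAt s := by
  rintro f ⟨r, y⟩ hy
  obtain rfl : r = s := hy
  have hP : ∀ r, ∃ c : x.G r, f ⟨r, 1⟩ = ⟨r, c⟩ := by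
    intro r
    have h1 := (f.map_rel (n := 1) (RelSymb.P r : x.lang.Relations 1) ![⟨r, 1⟩]).2 (by
      change (⟨r, 1⟩ : x.Model) ∈ x.P r
      rfl)
    have h2 : (f ⟨r, 1⟩).1 = r := h1
    rcases hf : f ⟨r, 1⟩ with ⟨r', c⟩
    rw [hf] at h2
    obtain rfl : r' = r := h2
    exact ⟨c, rfl⟩
  choose c hc using hP
  have h1 : c r = 1 := by
    by_contra hne
    refine h r ⟨fun s => c s.1, ?_, hne⟩
    rintro ⟨r₁, h₁⟩ ⟨r₂, h₂⟩ hS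
    have := (f.map_rel (n := 2) (RelSymb.Q r₁ r₂ hS : x.lang.Relations 2)
      ![⟨r₁, 1⟩, ⟨r₂, 1⟩]).2 (by
        change x.Q r₁ r₂ ⟨r₁, 1⟩ ⟨r₂, 1⟩
        rw [Q_mk]
        exact one_mem _)
    change x.Q r₁ r₂ (f ⟨r₁, 1⟩) (f ⟨r₂, 1⟩) at this
    rwa [hc, hc, Q_mk] at this
  have h2 := f.map_fun (n := 1) (FunSymb.F r y : x.lang.Functions 1) ![⟨r, 1⟩]
  change f (x.F r y ⟨r, 1⟩) = x.F r y (f ⟨r, 1⟩) at h2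
  rwa [F_self, hc, F_self, h1, mul_one] at h2

end Parameter

theorem exists_condTwo (hreg : lam.IsRegular) (hunc : ℵ₀ < lam) (hle : alphaStar ≤ lam.ord)
    (s : CountableSubsets lam) {α : Ordinal.{u}} (h0 : 0 < α)
    (hα : α < alphaStar) : ∃ t, (rootedParameter hreg.1 hle).CondTwo s α t := by
  have hsup : ∃ β < lam.ord, β = sSup (Order.succ '' s.1) ∧ s.1 ⊆ Iio β := by
    obtain ⟨b, hb, hlt⟩ := exists_bound hreg (mk_lt_lift_of_countable hunc s.2.2) s.2.1
    have hbd : b ∈ upperBounds (Order.succ '' s.1) := by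
      rintro _ ⟨γ, hγ, rfl⟩
      exact Order.succ_le_of_lt (hlt γ hγ)
    refine ⟨_, (csSup_le' hbd).trans_lt hb, rfl, fun γ hγ => ?_⟩
    exact (Order.lt_succ γ).trans_le (le_csSup ⟨b, hbd⟩ ⟨γ, hγ, rfl⟩)
  obtain ⟨β, hβ, hβs, hsβ⟩ := hsup
  have hgrow : Grows lam alphaStar α β (fun _ => 0) :=
    ⟨hα, hβ, fun _ _ => mem_Iio.2 h0, fun _ _ _ _ _ => le_rfl⟩
  have hidx : ∀ (r : CountableSubsets lam) (α' β : Ordinal.{u}) (g : Ordinal.{u} → Ordinal.{u})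
      (hg : Grows lam alphaStar α' β g) (hr : r.1 ⊆ Iio β),
      (rootedParameter hreg.1 hle).IsIndex (.pure r α' β g hg hr) r α' g (hOf β g) := by
    intro r α' β g hg hr
    refine ⟨rfl, rfl, fun γ hγ => if_pos hγ, fun γ hγ => ?_⟩
    exact (congrFun (Letter.codeH_of_root_eq _ rfl) γ).trans (if_pos hγ)
  refine ⟨.pure s α β _ hgrow hsβ, hreg, fun r => mk_lt_lift_of_countable hunc r.2.2, ?_, ?_, ?_⟩
  · intro r α' β g hg hr
    exact ⟨_, hidx r α' β g ⟨hg.1, hg.2, hg.3, hg.4⟩ hr⟩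
  · rintro t₁ t₂ hS ⟨α', β, g, hg, hr₁, hr₂, h₁, h₂⟩
    -- a letter with these values of `codeH` has root `0`, as the values are not `0`
    have key : ∀ t : Letter lam alphaStar, t.idx.1 ⊆ Iio β →
        (rootedParameter hreg.1 hle).IsIndex t t.idx α' g (hOf β g) →
        ∀ γ ∈ t.idx.1, t.mark γ = ⟨α', g γ, hOf β g γ⟩ := by
      intro t ht h γ hγ
      have hroot : t.root = 0 := by
        rcases t.root_spec with h' | ⟨-, ⟨γ', hγ', h''⟩, -⟩
        · exact h'
        · have h1 : t.codeH γ' = hOf β g γ' := h.h_eq hγ'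
          rw [t.codeH_of_lt h''] at h1
          exact absurd (lt_hOf hg.monotoneOn (ht hγ')) (h1 ▸ not_lt_zero)
      have h1 : t.codeH γ = hOf β g γ := h.h_eq hγ
      rw [t.codeH_of_root_eq hroot] at h1
      have h2 : t.g γ = g γ := h.g_eq hγ
      have h3 : t.cod = α' := h.alpha_eq
      rw [t.mark_of_le (by simp [hroot]), h1, h2, h3]
    refine ⟨hS, fun _ => h₁.alpha_eq.trans h₂.alpha_eq.symm, fun γ hγ => ?_⟩
    rw [key t₁ hr₁ h₁ γ hγ, key t₂ hr₂ h₂ γ (hS.1 hγ)]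
  · refine ⟨rfl, rfl, (hidx s α β _ hgrow hsβ).g_eq, fun γ hγ => ?_⟩
    rw [(hidx s α β _ hgrow hsβ).h_eq hγ, hOf_const]
    exact hβs

end Rigid

/-! ### Partial isomorphisms of the models -/

section PartialIso

variable {lam : Cardinal.{u}} {I : Type v} {J : Type w} (x : Parameter lam I J)

/-- Right multiplication with a compatible family of elements `c` of the groups `𝔾_r`, restricted to
any set, is a partial isomorphism. -/
theorem isPartialIso_of_family {s : I} {a₁ a₂ : x.G s} {z₁ z₂ : x.Model} (hz₁ : z₁ = ⟨s, a₁⟩)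
    (hz₂ : z₂ = ⟨s, a₂⟩) (E : ∀ r, x.G r → Prop)
    (huniq : ∀ r c c', E r c → E r c' → c = c')
    (hcoh : ∀ r₀ r c₀ c, E r₀ c₀ → E r c → (r₀, r) ∈ x.S → (c₀, c) ∈ x.G₂ r₀ r)
    {c₀ : x.G s} (hc₀ : E s c₀) (ha : a₂ = a₁ * c₀) (f : Set (Pointed z₁ × Pointed z₂))
    (hf : ∀ p ∈ f, ∃ r c y, E r c ∧ p.1 = (⟨r, y⟩ : x.Model) ∧ p.2 = (⟨r, y * c⟩ : x.Model)) :
    IsPartialIso (x.lang.withConstants Unit) (Pointed z₁) (Pointed z₂) f := by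
  have key : ∀ t : (x.lang.withConstants Unit).Term f, ∃ r c y, E r c ∧
      t.realize (M := Pointed z₁) (fun p => p.1.1) = (⟨r, y⟩ : x.Model) ∧
      t.realize (M := Pointed z₂) (fun p => p.1.2) = (⟨r, y * c⟩ : x.Model) := by
    intro t
    induction t with
    | var p => exact hf p.1 p.2
    | @func l F ts ih =>
      rcases F with F | F
      · rcases F with ⟨r', a⟩
        obtain ⟨r, c, y, hc, h1, h2⟩ := ih 0
        by_cases h : r = r'
        · subst h
          exact ⟨r, c, a * y, hc, (congrArg (x.F r a) h1).trans (x.F_self _ _ _),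
            (congrArg (x.F r a) h2).trans ((x.F_self _ _ _).trans (by rw [mul_assoc]))⟩
        · exact ⟨r, c, y, hc, (congrArg (x.F r' a) h1).trans (x.F_of_ne _ _ h),
            (congrArg (x.F r' a) h2).trans (x.F_of_ne _ _ h)⟩
      · match l, F with
        | 0, F => exact ⟨s, c₀, a₁, hc₀, hz₁, ha ▸ hz₂⟩
  constructor
  · intro t₁ t₂
    obtain ⟨r₁, c₁, y₁, hc₁, h1, h2⟩ := key t₁
    obtain ⟨r₂, c₂, y₂, hc₂, h3, h4⟩ := key t₂
    refine (iff_of_eq (congrArg₂ (fun z z' : x.Model => z = z') h1 h3)).trans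
      (Iff.trans ?_ (iff_of_eq (congrArg₂ (fun z z' : x.Model => z = z') h2 h4)).symm)
    constructor
    · intro h
      obtain ⟨rfl, h⟩ := Sigma.mk.inj h
      rw [eq_of_heq h, huniq _ _ _ hc₁ hc₂]
    · intro h
      obtain ⟨rfl, h⟩ := Sigma.mk.inj h
      have h' := eq_of_heq h
      rw [huniq _ _ _ hc₁ hc₂, mul_left_inj] at h'
      rw [h']
  · intro n R ts
    rcases R with R | R
    · rcases R with r | ⟨r₁, r₂, hS⟩
      · obtain ⟨r', c, y, hc, h1, h2⟩ := key (ts 0)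
        exact (iff_of_eq (congrArg (fun z => z ∈ x.P r) h1)).trans
          (Iff.trans Iff.rfl (iff_of_eq (congrArg (fun z => z ∈ x.P r) h2)).symm)
      · obtain ⟨r₁', c₁, y₁, hc₁, h1, h2⟩ := key (ts 0)
        obtain ⟨r₂', c₂, y₂, hc₂, h3, h4⟩ := key (ts 1)
        refine (iff_of_eq (congrArg₂ (x.Q r₁ r₂) h1 h3)).trans
          (Iff.trans ?_ (iff_of_eq (congrArg₂ (x.Q r₁ r₂) h2 h4)).symm)
        by_cases e1 : r₁' = r₁
        · by_cases e2 : r₂' = r₂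
          · subst e1 e2
            have h5 := hcoh _ _ _ _ hc₁ hc₂ hS
            have h6 : ((y₁ * c₁, y₂ * c₂) : x.G r₁' × x.G r₂') = (y₁, y₂) * (c₁, c₂) := rfl
            rw [x.Q_mk, x.Q_mk, h6, Subgroup.mul_mem_cancel_right _ h5]
          · refine iff_of_false ?_ ?_ <;>
            · rintro ⟨_, _, -, h, -⟩
              exact e2 (congrArg Sigma.fst h)
        · refine iff_of_false ?_ ?_ <;>
          · rintro ⟨_, _, h, -, -⟩
            exact e1 (congrArg Sigma.fst h)
    · exact isEmptyElim R

end PartialIso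

/-! ### The strategy of the player ISO -/

section Climb

variable (b : Ordinal.{u}) (d d' : Ordinal.{u} → Ordinal.{u})

/-- The height reached after `β` moves, when the play starts at the height `b` and the `j`-th move
of AIS asks for the height `d j`. -/
def top (β : Ordinal.{u}) : Ordinal.{u} := max b (sSup (d '' Iio β))

/-- The function that takes the value `j` at the points that come in at the `j`-th move. -/
def climb (γ : Ordinal.{u}) : Ordinal.{u} := sInf {j | γ < max b (d j)}

variable {b d d'} {β β' γ γ' : Ordinal.{u}}

theorem lt_top_iff : γ < top b d β ↔ γ < b ∨ ∃ j < β, γ < d j := by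
  rw [top, lt_max_iff]
  refine or_congr_right ⟨fun h => ?_, fun ⟨j, hj, h⟩ => ?_⟩
  · by_contra! h'
    exact h.not_ge (csSup_le' (by rintro _ ⟨j, hj, rfl⟩; exact h' j hj))
  · exact h.trans_le (le_csSup Ordinal.bddAbove_of_small ⟨j, hj, rfl⟩)

theorem top_mono (h : β' ≤ β) : top b d β' ≤ top b d β := by
  refine le_of_forall_lt fun γ hγ => ?_
  rw [lt_top_iff] at hγ ⊢
  exact hγ.imp_right fun ⟨j, hj, h'⟩ => ⟨j, hj.trans_le h, h'⟩

theorem climb_of_lt (h : γ < b) : climb b d γ = 0 :=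
  le_antisymm (csInf_le' (lt_max_of_lt_left h)) zero_le

theorem climb_set_nonempty (h : γ < top b d β) : {j | γ < max b (d j)}.Nonempty := by
  rcases lt_top_iff.1 h with h | ⟨j, -, h⟩
  · exact ⟨0, lt_max_of_lt_left h⟩
  · exact ⟨j, lt_max_of_lt_right h⟩

theorem climb_lt (h : γ < top b d β) (hb : b ≤ γ) : climb b d γ < β := by
  rcases lt_top_iff.1 h with h | ⟨j, hj, h⟩
  · exact (hb.not_gt h).elim
  · exact lt_of_le_of_lt (csInf_le' (lt_max_of_lt_right h : γ < max b (d j))) hj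

theorem climb_monotoneOn : MonotoneOn (climb b d) (Iio (top b d β)) := by
  intro γ _ γ' hγ' h
  exact csInf_le_csInf' (climb_set_nonempty hγ')
    fun j (hj : γ' < max b (d j)) => (h.trans_lt hj : γ < max b (d j))

theorem le_climb_top (h : top b d β' < top b d β) : β' ≤ climb b d (top b d β') := by
  refine le_csInf (climb_set_nonempty h) fun j hj => ?_
  by_contra! hlt
  have h1 : d j ≤ sSup (d '' Iio β') :=
    le_csSup Ordinal.bddAbove_of_small (mem_image_of_mem d (mem_Iio.2 hlt))
  have h2 : top b d β' < max b (d j) := hj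
  exact h2.not_ge (max_le_max_left b h1)

/-- The bounds of the climbing function do not change when the play goes on, since a later move
starts with a new value. -/
theorem hOf_climb (h : β' ≤ β) (hb : b ≤ γ) (hγ : γ < top b d β') :
    hOf (top b d β') (climb b d) γ = hOf (top b d β) (climb b d) γ := by
  apply le_antisymm
  · rcases le_or_gt (hOf (top b d β) (climb b d) γ) (top b d β') with h1 | h1
    · exact hOf_le_of_lt h1 fun h2 => (hOf_mem _ _ _).2 (h2.trans_le (top_mono h))
    · exact (hOf_le _ _ _).trans h1.le
  · refine hOf_le_of_lt ((hOf_le _ _ _).trans (top_mono h)) fun h1 => ?_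
    rcases (hOf_le (top b d β') (climb b d) γ).lt_or_eq with h2 | h2
    · exact (hOf_mem _ _ _).2 h2
    · rw [h2] at h1 ⊢
      exact (climb_lt hγ hb).trans_le (le_climb_top h1)

theorem thread_climb (α : Ordinal.{u}) (h : β' ≤ β) (hγ : γ < top b d β') :
    thread b α (top b d β') (climb b d) γ = thread b α (top b d β) (climb b d) γ := by
  rcases lt_or_ge γ b with h1 | h1
  · rw [thread_of_lt h1, thread_of_lt h1]
  · rw [thread_of_le h1, thread_of_le h1, hOf_climb h h1 hγ]

theorem top_congr (h : ∀ j < β, d j = d' j) : top b d β = top b d' β := by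
  have : d '' Iio β = d' '' Iio β := image_congr h
  rw [top, top, this]

theorem climb_le_of_congr (h : ∀ j < β, d j = d' j) (hγ : γ < top b d β) :
    climb b d' γ ≤ climb b d γ := by
  rcases lt_or_ge γ b with h1 | h1
  · rw [climb_of_lt h1]; exact zero_le
  · refine csInf_le' ?_
    have h2 := csInf_mem (climb_set_nonempty hγ)
    change γ < max b (d (climb b d γ)) at h2
    rwa [h _ (climb_lt hγ h1)] at h2

theorem climb_congr (h : ∀ j < β, d j = d' j) (hγ : γ < top b d β) :
    climb b d γ = climb b d' γ :=
  (climb_le_of_congr (fun j hj => (h j hj).symm) (top_congr h ▸ hγ)).antisymm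
    (climb_le_of_congr h hγ)

theorem hOf_congr {g g' : Ordinal.{u} → Ordinal.{u}} (h : EqOn g g' (Iio β)) (hγ : γ < β) :
    hOf β g γ = hOf β g' γ := by
  unfold hOf
  congr 1
  ext β'
  refine and_congr_right fun _ => forall_congr' fun h' => ?_
  rw [h hγ, h h']

theorem thread_congr (α : Ordinal.{u}) (h : ∀ j < β, d j = d' j) (hγ : γ < top b d β) :
    thread b α (top b d β) (climb b d) γ = thread b α (top b d' β) (climb b d') γ := by
  rcases lt_or_ge γ b with h1 | h1
  · rw [thread_of_lt h1, thread_of_lt h1]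
  · rw [thread_of_le h1, thread_of_le h1, climb_congr h hγ, ← top_congr h,
      hOf_congr (fun γ' hγ' => climb_congr h hγ') hγ]

end Climb

section Iso

variable {lam : Cardinal.{u}} {alphaStar : Ordinal.{u}} (hlam : ℵ₀ ≤ lam)
  (hle : alphaStar ≤ lam.ord)

local notation "𝔭" => rootedParameter hlam hle

/-- `c` is the generator of `𝔾_r` given by the thread with root `b` that climbs with the first `β`
moves. -/
def IsClimbLetter (b α : Ordinal.{u}) (d : Ordinal.{u} → Ordinal.{u}) (β : Ordinal.{u})
    (r : CountableSubsets lam) (c : (𝔭).G r) : Prop :=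
  ∃ t : {t // (𝔭).s t = r}, c = FreeGroup.of t ∧
    (∀ γ ∈ r.1, t.1.mark γ = thread b α (top b d β) (climb b d) γ) ∧ (r.1 = ∅ → t.1.cod = 1)

/-- The position of ISO after `β` moves.  An index belongs to it as soon as it lies below the height
reached after one of these moves, so that the position at a limit is the union of the earlier
ones. -/
def isoPosition (b α : Ordinal.{u}) (d : Ordinal.{u} → Ordinal.{u}) (β : Ordinal.{u}) :
    Set ((𝔭).Model × (𝔭).Model) :=
  {p | ∃ r c y, (∃ j < β, r.1 ⊆ Iio (top b d (Order.succ j))) ∧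
    IsClimbLetter hlam hle b α d β r c ∧ p.1 = ⟨r, y⟩ ∧ p.2 = ⟨r, y * c⟩}

variable {hlam hle} {b α β β' : Ordinal.{u}} {d d' : Ordinal.{u} → Ordinal.{u}}
  {r r₀ : CountableSubsets lam}

theorem IsClimbLetter.unique {c c' : (𝔭).G r} (h : IsClimbLetter hlam hle b α d β r c)
    (h' : IsClimbLetter hlam hle b α d β r c') : c = c' := by
  obtain ⟨⟨t, rfl⟩, rfl, h1, h2⟩ := h
  obtain ⟨⟨t', ht'⟩, rfl, h1', h2'⟩ := h'
  congr 2
  have hidx : t.idx = t'.idx := ht'.symm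
  rcases t.idx.1.eq_empty_or_nonempty with he | hne
  · exact t.eq_of_empty t' hidx he ((h2 he).trans (h2' he).symm)
  · exact t.eq_of_mark_eq hidx hne fun γ hγ => (h1 γ hγ).trans (h1' γ hγ).symm

theorem IsClimbLetter.coherent (hb : 0 < b) {c₀ : (𝔭).G r₀} {c : (𝔭).G r}
    (h₀ : IsClimbLetter hlam hle b α d β r₀ c₀) (h : IsClimbLetter hlam hle b α d β r c)
    (hS : (r₀, r) ∈ (𝔭).S) : (c₀, c) ∈ (𝔭).G₂ r₀ r := by
  obtain ⟨⟨t₀, rfl⟩, rfl, h1, h2⟩ := h₀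
  obtain ⟨⟨t, rfl⟩, rfl, h1', h2'⟩ := h
  refine Subgroup.subset_closure ⟨⟨t₀, rfl⟩, ⟨t, rfl⟩, ⟨hS, fun he => ?_, fun γ hγ => ?_⟩, rfl⟩
  · have hr : t.idx.1 = {0} := hS.2 he
    have h0 : (0 : Ordinal.{u}) ∈ t.idx.1 := by rw [hr]; rfl
    have hroot : t.root = 0 := by
      rcases t.root_spec with h | ⟨-, ⟨γ, hγ, h⟩, ⟨γ', hγ', h'⟩⟩
      · exact h
      · rw [hr, mem_singleton_iff] at hγ hγ'
        rw [hγ] at h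
        rw [hγ'] at h'
        exact (h'.not_gt h).elim
    have h3 := h1' 0 h0
    rw [thread_of_lt hb, t.mark_of_le (by rw [hroot])] at h3
    exact (h2 he).trans (congrArg Mark.cod h3).symm
  · exact (h1 γ hγ).trans (h1' γ (hS.1 hγ)).symm

theorem exists_isClimbLetter (h1 : 1 < alphaStar) (hb : 0 < b)
    (hg : Grows lam alphaStar α (top b d β) (climb b d)) (hr : r.1 ⊆ Iio (top b d β)) :
    ∃ c, IsClimbLetter hlam hle b α d β r c := by
  obtain ⟨t, rfl, h2, h3⟩ := exists_letter hg
    ((le_max_left b _).trans_lt hg.dom_lt) (fun _ => h1) r hr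
  exact ⟨_, ⟨t, rfl⟩, rfl, h2, fun he => h3 hb (by rw [he]; exact empty_subset _)⟩

theorem IsClimbLetter.congr {c : (𝔭).G r}
    (h : ∀ γ ∈ r.1, thread b α (top b d β) (climb b d) γ = thread b α (top b d' β') (climb b d') γ)
    (hc : IsClimbLetter hlam hle b α d β r c) : IsClimbLetter hlam hle b α d' β' r c := by
  obtain ⟨t, h1, h2, h3⟩ := hc
  exact ⟨t, h1, fun γ hγ => (h2 γ hγ).trans (h γ hγ), h3⟩

theorem isoPosition_subset_of_congr (h : ∀ j < β, d j = d' j) :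
    isoPosition hlam hle b α d β ⊆ isoPosition hlam hle b α d' β := by
  rintro p ⟨r, c, y, ⟨j, hj, hr⟩, hc, hp⟩
  have hj' : top b d (Order.succ j) = top b d' (Order.succ j) :=
    top_congr fun i hi => h i (hi.trans_le (Order.succ_le_of_lt hj))
  refine ⟨r, c, y, ⟨j, hj, hj' ▸ hr⟩, hc.congr fun γ hγ => ?_, hp⟩
  exact thread_congr α h ((hr hγ).trans_le (top_mono (Order.succ_le_of_lt hj)))

theorem isoPosition_mono (h : β' ≤ β) :
    isoPosition hlam hle b α d β' ⊆ isoPosition hlam hle b α d β := by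
  rintro p ⟨r, c, y, ⟨j, hj, hr⟩, hc, hp⟩
  refine ⟨r, c, y, ⟨j, hj.trans_le h, hr⟩, hc.congr fun γ hγ => ?_, hp⟩
  exact thread_climb α h ((hr hγ).trans_le (top_mono (Order.succ_le_of_lt hj)))

theorem isoPosition_limit (h : Order.IsSuccLimit β) :
    isoPosition hlam hle b α d β = ⋃ γ ∈ Iio β, isoPosition hlam hle b α d γ := by
  refine Subset.antisymm ?_ (iUnion₂_subset fun γ hγ => isoPosition_mono (mem_Iio.1 hγ).le)
  rintro p ⟨r, c, y, ⟨j, hj, hr⟩, hc, hp⟩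
  have hj' := h.succ_lt hj
  refine mem_iUnion₂.2 ⟨Order.succ j, hj', r, c, y, ⟨j, Order.lt_succ j, hr⟩,
    hc.congr fun γ hγ => (thread_climb α hj'.le (hr hγ)).symm, hp⟩

/-- The least height above all indices met by a move of AIS. -/
def demand (A : Set (𝔭).Model × Set (𝔭).Model) : Ordinal.{u} :=
  sSup (Order.succ '' ⋃ m ∈ A.1 ∪ A.2, m.1.1)

end Iso

section Iso

variable {lam : Cardinal.{u}} {alphaStar : Ordinal.{u}}

theorem one_add_lift (hunc : ℵ₀ < lam) :
    1 + Cardinal.lift.{u + 1} lam = Cardinal.lift.{u + 1} lam :=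
  add_eq_right (by simpa using hunc.le) (by simpa using (one_le_aleph0.trans hunc.le))

theorem demand_spec (hreg : lam.IsRegular) (hunc : ℵ₀ < lam) {hle : alphaStar ≤ lam.ord}
    {A : Set (rootedParameter hreg.1 hle).Model × Set (rootedParameter hreg.1 hle).Model}
    (hA : #A.1 + #A.2 < Cardinal.lift.{u + 1} lam) :
    demand A < lam.ord ∧ ∀ m ∈ A.1 ∪ A.2, m.1.1 ⊆ Iio (demand A) := by
  have hreg' : (Cardinal.lift.{u + 1} lam).IsRegular := hreg.lift
  have hcard : #(⋃ m ∈ A.1 ∪ A.2, m.1.1 : Set Ordinal.{u}) < Cardinal.lift.{u + 1} lam := by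
    refine (card_biUnion_lt_iff_forall_of_isRegular hreg' ?_).2 fun m _ =>
      mk_lt_lift_of_countable hunc m.1.2.2
    exact (mk_union_le _ _).trans_lt hA
  obtain ⟨β, hβ, hlt⟩ := exists_bound hreg hcard (by
    intro γ hγ
    obtain ⟨m, hm, hγ⟩ := mem_iUnion₂.1 hγ
    exact m.1.2.1 hγ)
  have hbd : β ∈ upperBounds (Order.succ '' ⋃ m ∈ A.1 ∪ A.2, m.1.1) := by
    rintro _ ⟨γ, hγ, rfl⟩
    exact Order.succ_le_of_lt (hlt γ hγ)
  refine ⟨(csSup_le' hbd).trans_lt hβ, fun m hm γ hγ => ?_⟩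
  exact (Order.lt_succ γ).trans_le (le_csSup ⟨β, hbd⟩ ⟨γ, mem_iUnion₂.2 ⟨m, hm, hγ⟩, rfl⟩)

/-- ISO wins the game of length `α < α^*` between `(M, (s, e))` and `(M, (s, x_t))`, when `t` is the
letter at `s` that consists of the root `b` only: he learns `α` from the length of the game, and
in the `j`-th move continues the thread by the value `j`. -/
theorem pointedEFEquiv_of_lt (hreg : lam.IsRegular) (hunc : ℵ₀ < lam) (hle : alphaStar ≤ lam.ord)
    (h1 : 1 < alphaStar) (s : CountableSubsets lam) {b : Ordinal.{u}} (hb : 0 < b)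
    (hbl : b < lam.ord) (hs : s.1 ⊆ Iio b)
    {t : {t // (rootedParameter hreg.1 hle).s t = s}}
    (ht : ∀ γ ∈ s.1, t.1.mark γ = ⟨1, 0, b⟩) (hcod : t.1.cod = 1)
    {z₁ z₂ : (rootedParameter hreg.1 hle).Model} (hz₁ : z₁ = ⟨s, 1⟩)
    (hz₂ : z₂ = ⟨s, FreeGroup.of t⟩)
    {α : Ordinal.{u}} (hα : α < alphaStar) :
    PointedEFEquiv (rootedParameter hreg.1 hle).lang (rootedParameter hreg.1 hle).Model
      z₁ z₂ α (Cardinal.lift.{u + 1} lam) := by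
  set α' := max 1 α with hα'
  have hdem : ∀ A : Ordinal.{u} → Set (rootedParameter hreg.1 hle).Model ×
      Set (rootedParameter hreg.1 hle).Model, (∀ β < α, #(A β).1 + #(A β).2 <
        1 + Cardinal.lift.{u + 1} lam) → ∀ β < α, demand (A β) < lam.ord ∧
        ∀ m ∈ (A β).1 ∪ (A β).2, m.1.1 ⊆ Iio (demand (A β)) := fun A hA β hβ =>
    demand_spec hreg hunc (by rw [← one_add_lift hunc]; exact hA β hβ)
  have hgrow : ∀ A : Ordinal.{u} → Set (rootedParameter hreg.1 hle).Model ×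
      Set (rootedParameter hreg.1 hle).Model, (∀ β < α, #(A β).1 + #(A β).2 <
        1 + Cardinal.lift.{u + 1} lam) → ∀ β ≤ α,
        Grows lam alphaStar α' (top b (fun j => demand (A j)) β)
          (climb b fun j => demand (A j)) := by
    intro A hA β hβ
    refine ⟨max_lt h1 hα, max_lt hbl ?_, fun γ hγ => ?_, climb_monotoneOn⟩
    · obtain ⟨β₀, hβ₀, hlt⟩ := exists_bound hreg
        (s := (fun j => demand (A j)) '' Iio β)
        (mk_image_le.trans_lt (mk_Iio_lt_lift ((hβ.trans_lt hα).trans_le hle))) (by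
          rintro _ ⟨j, hj, rfl⟩
          exact (hdem A hA j (hj.trans_le hβ)).1)
      exact (csSup_le' fun γ hγ => (hlt γ hγ).le).trans_lt hβ₀
    · rcases lt_or_ge γ b with h | h
      · rw [mem_Iio, climb_of_lt h]
        exact zero_lt_one.trans_le (le_max_left _ _)
      · exact ((climb_lt hγ h).trans_le hβ).trans_le (le_max_right _ _)
  refine ⟨fun A β => isoPosition hreg.1 hle b α' (fun j => demand (A j)) β, ?_⟩
  have hpartner : ∀ A : Ordinal.{u} → Set (rootedParameter hreg.1 hle).Model ×
      Set (rootedParameter hreg.1 hle).Model, (∀ β < α, #(A β).1 + #(A β).2 <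
        1 + Cardinal.lift.{u + 1} lam) → ∀ β < α, ∀ m ∈ (A β).1 ∪ (A β).2,
        ∃ c, IsClimbLetter hreg.1 hle b α' (fun j => demand (A j)) (Order.succ β) m.1 c ∧
          m.1.1 ⊆ Iio (top b (fun j => demand (A j)) (Order.succ β)) := by
    intro A hA β hβ m hm
    have hsub : m.1.1 ⊆ Iio (top b (fun j => demand (A j)) (Order.succ β)) := fun γ hγ =>
      lt_top_iff.2 (Or.inr ⟨β, Order.lt_succ β, (hdem A hA β hβ).2 m hm hγ⟩)
    obtain ⟨c, hc⟩ := exists_isClimbLetter (hlam := hreg.1) (hle := hle) h1 hb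
      (hgrow A hA _ (Order.succ_le_of_lt hβ)) hsub
    exact ⟨c, hc, hsub⟩
  refine ⟨?_, ?_, ?_, ?_, ?_, ?_, ?_⟩
  · intro A A' β hβ h
    have h' : ∀ j < β, demand (hlam := hreg.1) (hle := hle) (A j) = demand (A' j) :=
      fun j hj => by rw [h j hj]
    exact (isoPosition_subset_of_congr h').antisymm
      (isoPosition_subset_of_congr fun j hj => (h' j hj).symm)
  · intro A hA
    refine eq_empty_of_forall_notMem ?_
    rintro p ⟨r, c, y, ⟨j, hj, -⟩, -⟩
    exact not_lt_zero hj
  · intro A hA β hβ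
    refine isPartialIso_of_family _ hz₁ hz₂
      (fun r c => IsClimbLetter hreg.1 hle b α' (fun j => demand (A j)) β r c)
      (fun _ _ _ h h' => h.unique h') (fun _ _ _ _ h h' hS => h.coherent hb h' hS)
      (c₀ := FreeGroup.of t) ⟨t, rfl, fun γ hγ => ?_, fun _ => hcod⟩ (one_mul _).symm _ ?_
    · rw [ht γ hγ, thread_of_lt (hs hγ)]
    · rintro p ⟨r, c, y, -, hc, hp⟩
      exact ⟨r, c, y, hc, hp⟩
  · intro A hA β hβ
    exact isoPosition_mono (Order.le_succ β)
  · rintro A hA β hβ ⟨r, y⟩ hm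
    obtain ⟨c, hc, hsub⟩ := hpartner A hA β hβ _ (Or.inl hm)
    exact ⟨(⟨r, y⟩, ⟨r, y * c⟩), ⟨r, c, y, ⟨β, Order.lt_succ β, hsub⟩, hc, rfl, rfl⟩, rfl⟩
  · rintro A hA β hβ ⟨r, y⟩ hm
    obtain ⟨c, hc, hsub⟩ := hpartner A hA β hβ _ (Or.inr hm)
    refine ⟨(⟨r, y * c⁻¹⟩, ⟨r, y⟩), ⟨r, c, y * c⁻¹, ⟨β, Order.lt_succ β, hsub⟩, hc, rfl, ?_⟩, rfl⟩
    rw [inv_mul_cancel_right]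
  · intro A hA β hβ hlim
    exact isoPosition_limit hlim

end Iso

/-! ### Ladders -/

section Ladder

theorem mk_finset_subset_lt {X : Type w} {s : Set X} {c : Cardinal.{w}} (hc : ℵ₀ ≤ c)
    (hs : #s < c) : #{x : Finset X | ↑x ⊆ s} < c := by
  classical
  have h1 : #{x : Finset X | ↑x ⊆ s} ≤ #(Finset s) := by
    refine mk_le_of_injective (f := fun x => x.1.subtype (· ∈ s)) fun x y hxy => ?_
    have h2 := congrArg (Finset.map (Function.Embedding.subtype (· ∈ s))) hxy
    simp only [Finset.subtype_map] at h2
    rw [Finset.filter_true_of_mem x.2, Finset.filter_true_of_mem y.2] at h2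
    exact Subtype.ext h2
  refine h1.trans_lt ?_
  rcases finite_or_infinite s with h | h
  · exact (lt_aleph0_of_finite _).trans_le hc
  · rwa [mk_finset_of_infinite]

/-- For every limit ordinal `i` there are at most `|i|` sequences in `i` such that every function
`φ` from finite subsets of `i` to `i` has a sequence among them that grows beyond the values of
`φ` at its finite parts: along a cofinal subset of order type `cof i`, take ladders of all ordinals
of countable cofinality, and use that some such ordinal (`cof i` itself if it is `ω`) is closed
under `φ`. -/
theorem exists_ladder_family {i : Ordinal.{u}} (hi : Order.IsSuccLimit i) :
    ∃ F : Ordinal.{u} → ℕ → Ordinal.{u}, ∀ φ : Finset Ordinal.{u} → Ordinal.{u},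
      (∀ x, φ x < i) → ∃ k ≤ i, StrictMono (F k) ∧ (∀ m, F k m < i) ∧
        ∀ M, ∃ m, φ ((Finset.range M).image (F k)) < F k m := by
  classical
  have hreg : i.cof.IsRegular := isRegular_cof hi
  have hκlim : Order.IsSuccLimit i.cof.ord := isSuccLimit_ord hreg.1
  obtain ⟨f, hf⟩ := exists_isFundamentalSeq (o := i) rfl
  set e : Ordinal.{u} → Ordinal.{u} := fun ξ =>
    if h : ξ < i.cof.ord then (f ⟨ξ, h⟩).1 else 0 with he
  have hemono : ∀ ξ ξ', ξ < ξ' → ξ' < i.cof.ord → e ξ < e ξ' := by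
    intro ξ ξ' h h'
    simp only [he, h', h.trans h', dif_pos]
    exact hf.strictMono (show (⟨ξ, h.trans h'⟩ : Iio i.cof.ord) < ⟨ξ', h'⟩ from h)
  have helt : ∀ ξ < i.cof.ord, e ξ < i := by
    intro ξ h
    simp only [he, h, dif_pos]
    exact (f ⟨ξ, h⟩).2
  have hecof : ∀ ρ < i, ∃ ξ < i.cof.ord, ρ < e ξ := by
    intro ρ hρ
    obtain ⟨_, ⟨ξ, rfl⟩, h⟩ := hf.isCofinal_range ⟨ρ, hρ⟩
    refine ⟨Order.succ ξ.1, hκlim.succ_lt ξ.2, ?_⟩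
    refine lt_of_le_of_lt ?_ (hemono ξ.1 _ (Order.lt_succ _) (hκlim.succ_lt ξ.2))
    have h2 : e ξ.1 = (f ξ).1 := dif_pos (show ξ.1 < i.cof.ord from ξ.2)
    rw [h2]
    exact h
  have hlad : ∀ k : Ordinal.{u}, ∃ G : ℕ → Ordinal.{u},
      (∃ G : ℕ → Ordinal.{u}, StrictMono G ∧ (∀ m, G m < k) ∧ ∀ ρ < k, ∃ m, ρ ≤ G m) →
      StrictMono G ∧ (∀ m, G m < k) ∧ ∀ ρ < k, ∃ m, ρ ≤ G m := by
    intro k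
    by_cases h : ∃ G : ℕ → Ordinal.{u}, StrictMono G ∧ (∀ m, G m < k) ∧ ∀ ρ < k, ∃ m, ρ ≤ G m
    · exact ⟨h.choose, fun _ => h.choose_spec⟩
    · exact ⟨fun _ => 0, fun h' => (h h').elim⟩
  choose G hG using hlad
  refine ⟨fun k m => e (G k m), fun φ hφ => ?_⟩
  have hΨ : ∀ ξ < i.cof.ord, ∃ ξ', ξ < ξ' ∧ ξ' < i.cof.ord ∧
      ∀ x : Finset Ordinal.{u}, ↑x ⊆ Iio ξ → φ (x.image e) < e ξ' := by
    intro ξ hξ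
    choose p hp hp' using fun x : Finset Ordinal.{u} => hecof (φ (x.image e)) (hφ _)
    obtain ⟨b, hb, hlt⟩ := exists_bound hreg (s := p '' {x | ↑x ⊆ Iio ξ})
      (mk_image_le.trans_lt (mk_finset_subset_lt (aleph0_le_lift.2 hreg.1) (mk_Iio_lt_lift hξ)))
      (by rintro _ ⟨x, -, rfl⟩; exact hp x)
    have hm : max b (Order.succ ξ) < i.cof.ord := max_lt hb (hκlim.succ_lt hξ)
    refine ⟨_, (Order.lt_succ ξ).trans_le (le_max_right b _), hm, fun x hx => ?_⟩
    exact (hp' x).trans (hemono _ _ ((hlt _ ⟨x, hx, rfl⟩).trans_le (le_max_left _ _)) hm)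
  choose! Ψ hΨ1 hΨ2 hΨ3 using hΨ
  set ξ : ℕ → Ordinal.{u} := fun n => Ψ^[n] 0 with hξ
  have hξs : ∀ n, ξ (n + 1) = Ψ (ξ n) := fun n => Function.iterate_succ_apply' _ _ _
  have hξlt : ∀ n, ξ n < i.cof.ord := by
    intro n
    induction n with
    | zero => exact hreg.ord_pos
    | succ n ih => rw [hξs]; exact hΨ2 _ ih
  have hξmono : StrictMono ξ := strictMono_nat_of_lt_succ fun n => by
    rw [hξs]; exact hΨ1 _ (hξlt n)
  set k := ⨆ n, ξ n with hk
  have hltk : ∀ ρ, ρ < k ↔ ∃ n, ρ < ξ n := fun ρ => Ordinal.lt_iSup_iff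
  have hkle : k ≤ i.cof.ord := Ordinal.iSup_le fun n => (hξlt n).le
  have hξk : ∀ n, ξ n < k := fun n => (hltk _).2 ⟨n + 1, hξmono n.lt_succ_self⟩
  obtain ⟨hG1, hG2, hG3⟩ := hG k ⟨ξ, hξmono, hξk, fun ρ hρ => by
    obtain ⟨n, hn⟩ := (hltk ρ).1 hρ
    exact ⟨n, hn.le⟩⟩
  refine ⟨k, hkle.trans (ord_cof_le i), fun m m' h => hemono _ _ (hG1 h) ((hG2 m').trans_le hkle),
    fun m => helt _ ((hG2 m).trans_le hkle), fun M => ?_⟩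
  obtain ⟨n, hn⟩ := (hltk _).1 (hG2 M)
  obtain ⟨m, hm⟩ := hG3 _ (hξk (n + 1))
  refine ⟨m, lt_of_lt_of_le ?_ (?_ : e (ξ (n + 1)) ≤ _)⟩
  · have := hΨ3 (ξ n) (hξlt n) ((Finset.range M).image (G k)) (by
      intro ρ hρ
      obtain ⟨j, hj, rfl⟩ := Finset.mem_image.1 (Finset.mem_coe.1 hρ)
      exact (hG1 (Finset.mem_range.1 hj)).trans hn)
    rwa [Finset.image_image, ← hξs] at this
  · rcases hm.lt_or_eq with h | h
    · exact (hemono _ _ h ((hG2 m).trans_le hkle)).le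
    · rw [h]

end Ladder

/-! ### The strategy of the player AIS -/

section GoodPlay

variable {lam : Cardinal.{u}} {alphaStar : Ordinal.{u}}

/-- `x` witnesses that the play has forced the value `j` at the height `β j`: over the index
`s ∪ x`, where `x` consists of heights up to `β j`, some letter over `t₁` has a value `≥ j` at
`β j`. -/
def Witness (s : Set Ordinal.{u}) (L : Set Ordinal.{u} → Set (Letter lam alphaStar))
    (β : Ordinal.{u} → Ordinal.{u}) (t₁ : Letter lam alphaStar) (j : Ordinal.{u})
    (x : Finset Ordinal.{u}) : Prop :=
  ↑x ⊆ β '' Iic j ∧ β 0 ∈ x ∧ β j ∈ x ∧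
    ∃ t ∈ L (s ∪ x), EqOn t.mark t₁.mark (s ∪ {β 0}) ∧ j ≤ (t.mark (β j)).val

/-- The record of a play in which AIS asks in the `i`-th move for a height `β i` above all bounds
met before, for the indices `s ∪ x` with finite sets `x` of heights up to `β i`, and at limits `i`
for the unions of witnesses along the ladders `F i k`.  `L` are the letters of the answers. -/
structure IsGoodPlay (s : Set Ordinal.{u}) (b : Ordinal.{u}) (tStar t₁ : Letter lam alphaStar)
    (F : Ordinal.{u} → Ordinal.{u} → ℕ → Ordinal.{u}) (β : Ordinal.{u} → Ordinal.{u})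
    (D : Set (Set Ordinal.{u})) (L : Set Ordinal.{u} → Set (Letter lam alphaStar)) : Prop where
  system : IsLetterSystem D L
  le_height : ∀ i < alphaStar, b ≤ β i
  first_mem : t₁ ∈ L (s ∪ {β 0})
  first_mark : EqOn t₁.mark tStar.mark s
  bound_le : ∀ i < alphaStar, ∀ x : Finset Ordinal.{u}, ↑x ⊆ β '' Iio i → ∀ t ∈ L (s ∪ x),
    ∀ γ ∈ x, (t.mark γ).bound ≤ β i
  finite_mem : ∀ i < alphaStar, ∀ x : Finset Ordinal.{u}, ↑x ⊆ β '' Iic i → s ∪ ↑x ∈ D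
  ladder_mem : ∀ i < alphaStar, Order.IsSuccLimit i → (∀ j < i, ∃ x, Witness s L β t₁ j x) →
    ∃ w : Ordinal.{u} → Finset Ordinal.{u}, (∀ j < i, Witness s L β t₁ j (w j)) ∧
      ∀ k ≤ i, (∀ m, F i k m < i) → s ∪ insert (β i) (⋃ m, (w (F i k m) : Set Ordinal.{u})) ∈ D

variable {s : Set Ordinal.{u}} {b : Ordinal.{u}} {tStar t₁ : Letter lam alphaStar}
  {F : Ordinal.{u} → Ordinal.{u} → ℕ → Ordinal.{u}} {β : Ordinal.{u} → Ordinal.{u}}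
  {D : Set (Set Ordinal.{u})} {L : Set Ordinal.{u} → Set (Letter lam alphaStar)}

/-- In a good play, passing a bound of a letter over `t₁` increases the value. -/
theorem IsGoodPlay.val_lt_val (h : IsGoodPlay s b tStar t₁ F β D L) (hs : s.Nonempty)
    (hm : ∀ γ ∈ s, tStar.mark γ = ⟨1, 0, b⟩) {X : Set Ordinal.{u}} (hX : X ∈ D) (hsX : s ⊆ X)
    {t : Letter lam alphaStar} (ht : t ∈ L X) (ht₁ : EqOn t.mark t₁.mark (s ∪ {β 0}))
    {γ γ' : Ordinal.{u}} (hγ : γ ∈ X) (hγ' : γ' ∈ X) (hb : b ≤ γ) (hle : (t.mark γ).bound ≤ γ') :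
    (t.mark γ).val < (t.mark γ').val := by
  obtain ⟨γ₀, hγ₀⟩ := hs
  have hidx := h.system.idx_eq _ hX _ ht
  refine t.mark_val_lt_val (γ₀ := γ₀) (by rw [hidx]; exact hsX hγ₀) (by rwa [hidx])
    (by rwa [hidx]) ?_ hle
  rw [ht₁ (Or.inl hγ₀), h.first_mark hγ₀, hm γ₀ hγ₀]
  exact hb

/-- In a good play, the values of letters over `t₁` stay below the codomain of `t₁`. -/
theorem IsGoodPlay.val_lt_cod (h : IsGoodPlay s b tStar t₁ F β D L) (h0 : 0 < alphaStar)
    (hs : s.Nonempty) (hm : ∀ γ ∈ s, tStar.mark γ = ⟨1, 0, b⟩) {X : Set Ordinal.{u}} (hX : X ∈ D)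
    (hsX : s ∪ {β 0} ⊆ X) {t : Letter lam alphaStar} (ht : t ∈ L X)
    (ht₁ : EqOn t.mark t₁.mark (s ∪ {β 0})) {γ : Ordinal.{u}} (hγ : γ ∈ X) (hb : b ≤ γ) :
    (t.mark γ).val < (t₁.mark (β 0)).cod := by
  obtain ⟨γ₀, hγ₀⟩ := hs
  have hidx := h.system.idx_eq _ hX _ ht
  have hγ₀' : γ₀ ∈ t.idx.1 := by rw [hidx]; exact hsX (Or.inl hγ₀)
  have hbound : (t.mark γ₀).bound = b := by
    rw [ht₁ (Or.inl hγ₀), h.first_mark hγ₀, hm γ₀ hγ₀]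
  rw [← ht₁ (Or.inr rfl), t.mark_cod_of_bound_le hγ₀' (hbound.trans_le (h.le_height 0 h0)),
    ← t.mark_cod_of_bound_le hγ₀' (hbound.trans_le hb)]
  exact t.mark_val_lt_cod (by rwa [hidx])

/-- Finitely many letters over `X` are told apart by their marks on one of the sets `Y m`. -/
theorem exists_separating (hsys : IsLetterSystem D L) {X : Set Ordinal.{u}} (hX : X ∈ D)
    (hne : X.Nonempty) {Y : ℕ → Set Ordinal.{u}} (hY : Monotone Y) (hXY : X ⊆ ⋃ m, Y m) :
    ∃ M, ∀ t ∈ L X, ∀ t' ∈ L X, EqOn t.mark t'.mark (Y M) → t = t' := by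
  classical
  have h : ∀ p : Letter lam alphaStar × Letter lam alphaStar, ∃ M, p.1 ∈ L X → p.2 ∈ L X →
      EqOn p.1.mark p.2.mark (Y M) → p.1 = p.2 := by
    rintro ⟨t, t'⟩
    by_cases hp : t ∈ L X ∧ t' ∈ L X ∧ t ≠ t'
    · have h1 : ¬ EqOn t.mark t'.mark X := fun h' => hp.2.2
        (Letter.eq_of_eqOn (hsys.idx_eq _ hX _ hp.1) (hsys.idx_eq _ hX _ hp.2.1) hne h')
      simp only [EqOn, not_forall] at h1
      obtain ⟨γ, hγ, hne'⟩ := h1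
      obtain ⟨M, hM⟩ := mem_iUnion.1 (hXY hγ)
      exact ⟨M, fun _ _ h' => (hne' (h' hM)).elim⟩
    · refine ⟨0, fun h1 h2 _ => ?_⟩
      by_contra h3
      exact hp ⟨h1, h2, h3⟩
  choose N hN using h
  have hfin := (hsys.finite X hX).prod (hsys.finite X hX)
  refine ⟨hfin.toFinset.sup N, fun t ht t' ht' h' => hN (t, t') ht ht' (h'.mono (hY ?_))⟩
  exact Finset.le_sup (f := N) (hfin.mem_toFinset.2 ⟨ht, ht'⟩)

theorem exists_bound_of_values (hfin : (L s).Finite) (γ : Ordinal.{u}) {i : Ordinal.{u}}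
    (hi : 0 < i) : ∃ v < i, ∀ t ∈ L s, (t.mark γ).val < i → (t.mark γ).val ≤ v := by
  classical
  set V := (hfin.toFinset.image fun t => (t.mark γ).val).filter (· < i) with hV
  refine ⟨V.sup id, (Finset.sup_lt_iff hi).2 fun v hv => (Finset.mem_filter.1 hv).2, ?_⟩
  intro t ht h
  exact Finset.le_sup (f := id)
    (Finset.mem_filter.2 ⟨Finset.mem_image.2 ⟨t, hfin.mem_toFinset.2 ht, rfl⟩, h⟩)

/-- The limit step.  Some letter `T` over the union of witnesses along a ladder extends infinitely
many of the witnessing letters, and so exceeds the ladder at `β i`.  Finitely many witnesses suffice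
to tell apart the letters over this union; hence `T` restricts to a letter over a finite part, and
by the choice of the ladder its value is at least `i`. -/
theorem IsGoodPlay.exists_witness_limit (h : IsGoodPlay s b tStar t₁ F β D L)
    (hs : s.Nonempty) (hm : ∀ γ ∈ s, tStar.mark γ = ⟨1, 0, b⟩) {i : Ordinal.{u}}
    (hi : i < alphaStar) (hlim : Order.IsSuccLimit i)
    (hF : ∀ φ : Finset Ordinal.{u} → Ordinal.{u}, (∀ x, φ x < i) → ∃ k ≤ i, StrictMono (F i k) ∧
      (∀ m, F i k m < i) ∧ ∀ M, ∃ m, φ ((Finset.range M).image (F i k)) < F i k m)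
    (ih : ∀ j < i, ∃ x, Witness s L β t₁ j x) : ∃ x, Witness s L β t₁ i x := by
  classical
  obtain ⟨w, hw, hwD⟩ := h.ladder_mem i hi hlim ih
  set z : Finset Ordinal.{u} → Finset Ordinal.{u} := fun y => insert (β i) (y.biUnion w) with hz
  have hzsub : ∀ y : Finset Ordinal.{u}, ↑y ⊆ Iio i → (z y : Set Ordinal.{u}) ⊆ β '' Iic i := by
    intro y hy γ hγ
    rcases Finset.mem_insert.1 (Finset.mem_coe.1 hγ) with rfl | hγ
    · exact ⟨i, mem_Iic.2 le_rfl, rfl⟩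
    · obtain ⟨j, hj, hγ⟩ := Finset.mem_biUnion.1 hγ
      have hji : j < i := hy hj
      obtain ⟨j', hj', rfl⟩ := (hw j hji).1 hγ
      exact ⟨j', (mem_Iic.1 hj').trans hji.le, rfl⟩
  have hφ : ∀ y : Finset Ordinal.{u}, ∃ v < i, ↑y ⊆ Iio i → ∀ t ∈ L (s ∪ z y),
      (t.mark (β i)).val < i → (t.mark (β i)).val ≤ v := by
    intro y
    by_cases hy : ↑y ⊆ Iio i
    · obtain ⟨v, hv, hv'⟩ := exists_bound_of_values
        (h.system.finite _ (h.finite_mem i hi _ (hzsub y hy))) (β i) hlim.bot_lt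
      exact ⟨v, hv, fun _ => hv'⟩
    · exact ⟨0, hlim.bot_lt, fun h' => (hy h').elim⟩
  choose φ hφi hφ using hφ
  obtain ⟨k, hk, hmono, hFi, hesc⟩ := hF φ hφi
  set X : Set Ordinal.{u} := s ∪ insert (β i) (⋃ m, (w (F i k m) : Set Ordinal.{u})) with hXdef
  have hX : X ∈ D := hwD k hk hFi
  have hsX : s ⊆ X := subset_union_left
  have hβX : β i ∈ X := Or.inr (mem_insert _ _)
  have hwX : ∀ m, s ∪ (w (F i k m) : Set Ordinal.{u}) ⊆ X := fun m =>
    union_subset_union_right s ((subset_iUnion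
      (fun m => (w (F i k m) : Set Ordinal.{u})) m).trans (subset_insert _ _))
  have hwmem : ∀ m, s ∪ (w (F i k m) : Set Ordinal.{u}) ∈ D := fun m => by
    refine h.finite_mem i hi _ ((hw _ (hFi m)).1.trans (image_mono ?_))
    exact Iic_subset_Iic.2 (hFi m).le
  -- letters over `X` that extend the witnessing letters
  have hT : ∀ m, ∃ T : L X, EqOn T.1.mark t₁.mark (s ∪ {β 0}) ∧ F i k m < (T.1.mark (β i)).val := by
    intro m
    obtain ⟨hw1, hw2, hw3, t, ht, ht₁, hval⟩ := hw _ (hFi m)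
    obtain ⟨T, hT, hTt⟩ := h.system.exists_extension _ (hwmem m) X hX (hwX m) (hs.inl) t ht
    have hT₁ : EqOn T.mark t₁.mark (s ∪ {β 0}) := by
      refine EqOn.trans (hTt.mono ?_) ht₁
      exact union_subset_union_right s (singleton_subset_iff.2 hw2)
    refine ⟨⟨T, hT⟩, hT₁, ?_⟩
    have hmem : β (F i k m) ∈ s ∪ (w (F i k m) : Set Ordinal.{u}) := Or.inr hw3
    have h1 : (T.mark (β (F i k m))).bound ≤ β i := by
      rw [hTt hmem]
      refine h.bound_le i hi (w (F i k m)) (hw1.trans (image_mono ?_)) t ht _ hw3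
      exact fun j hj => (mem_Iic.1 hj).trans_lt (hFi m)
    refine lt_of_le_of_lt ?_ (h.val_lt_val hs hm hX hsX hT hT₁ (hwX m hmem) hβX
      (h.le_height _ ((hFi m).trans hi)) h1)
    rw [hTt hmem]
    exact hval
  choose T hT₁ hTval using hT
  have : Finite (L X) := h.system.finite X hX
  obtain ⟨T₀, hT₀⟩ := Finite.exists_infinite_fiber T
  have hT₀' : (T ⁻¹' {T₀}).Infinite := infinite_coe_iff.1 hT₀
  have hT₀₁ : EqOn T₀.1.mark t₁.mark (s ∪ {β 0}) := by
    obtain ⟨m, hm'⟩ := hT₀'.nonempty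
    have hm'' : T m = T₀ := hm'
    rw [← hm'']
    exact hT₁ m
  have hT₀val : ∀ m, F i k m < (T₀.1.mark (β i)).val := by
    intro m
    obtain ⟨m', hm', hlt⟩ := hT₀'.exists_gt m
    have hm'' : T m' = T₀ := hm'
    rw [← hm'']
    exact (hmono hlt).trans (hTval m')
  -- finitely many witnesses separate the letters over `X`
  obtain ⟨M, hM⟩ := exists_separating h.system hX hs.inl
    (Y := fun M => s ∪ (z ((Finset.range (M + 1)).image (F i k)) : Set Ordinal.{u})) (by
      intro M M' hMM
      refine union_subset_union_right s (Finset.coe_subset.2 (Finset.insert_subset_insert _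
        (Finset.biUnion_subset_biUnion_of_subset_left _ (Finset.image_subset_image ?_))))
      exact Finset.range_subset_range.2 (Nat.succ_le_succ hMM)) (by
      rintro γ (hγ | hγ)
      · exact mem_iUnion.2 ⟨0, Or.inl hγ⟩
      · rcases hγ with rfl | hγ
        · exact mem_iUnion.2 ⟨0, Or.inr (Finset.mem_coe.2 (Finset.mem_insert_self _ _))⟩
        · obtain ⟨m, hγ⟩ := mem_iUnion.1 hγ
          refine mem_iUnion.2 ⟨m, Or.inr (Finset.mem_coe.2 (Finset.mem_insert_of_mem
            (Finset.mem_biUnion.2 ⟨F i k m, Finset.mem_image.2 ⟨m, ?_, rfl⟩, hγ⟩)))⟩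
          exact Finset.mem_range.2 m.lt_succ_self)
  set y := (Finset.range (M + 1)).image (F i k) with hy
  have hyi : (y : Set Ordinal.{u}) ⊆ Iio i := by
    intro j hj
    obtain ⟨m, -, rfl⟩ := Finset.mem_image.1 (Finset.mem_coe.1 hj)
    exact hFi m
  have hzD := h.finite_mem i hi _ (hzsub y hyi)
  have hzX : s ∪ (z y : Set Ordinal.{u}) ⊆ X := by
    refine union_subset_union_right s fun γ hγ => ?_
    rcases Finset.mem_insert.1 (Finset.mem_coe.1 hγ) with rfl | hγ
    · exact mem_insert _ _
    · obtain ⟨j, hj, hγ⟩ := Finset.mem_biUnion.1 hγ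
      obtain ⟨m, -, rfl⟩ := Finset.mem_image.1 hj
      exact Or.inr (mem_iUnion.2 ⟨m, hγ⟩)
  obtain ⟨t, ht, htT⟩ := h.system.exists_restriction _ hzD X hX hzX hs.inl hM T₀.1 T₀.2
  have hβz : β i ∈ z y := Finset.mem_insert_self _ _
  have hβ0z : β 0 ∈ z y := Finset.mem_insert_of_mem (Finset.mem_biUnion.2 ⟨F i k 0,
    Finset.mem_image.2 ⟨0, Finset.mem_range.2 M.succ_pos, rfl⟩, (hw _ (hFi 0)).2.1⟩)
  have hval := htT (Or.inr hβz : β i ∈ s ∪ (z y : Set Ordinal.{u}))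
  refine ⟨z y, hzsub y hyi, hβ0z, hβz, t, ht, (htT.mono ?_).trans hT₀₁, ?_⟩
  · exact union_subset_union_right s (singleton_subset_iff.2 hβ0z)
  · by_contra! hlt
    obtain ⟨m, hm'⟩ := hesc (M + 1)
    have h1 := hφ y hyi t ht hlt
    rw [hval] at h1
    exact (h1.trans_lt (hm'.trans (hT₀val m))).false

/-- In a good play, AIS forces a value `≥ i` at the height `β i`. -/
theorem IsGoodPlay.exists_witness (h : IsGoodPlay s b tStar t₁ F β D L)
    (hs : s.Nonempty) (hm : ∀ γ ∈ s, tStar.mark γ = ⟨1, 0, b⟩)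
    (hF : ∀ i, Order.IsSuccLimit i → ∀ φ : Finset Ordinal.{u} → Ordinal.{u}, (∀ x, φ x < i) →
      ∃ k ≤ i, StrictMono (F i k) ∧
      (∀ m, F i k m < i) ∧ ∀ M, ∃ m, φ ((Finset.range M).image (F i k)) < F i k m)
    (i : Ordinal.{u}) (hi : i < alphaStar) : ∃ x, Witness s L β t₁ i x := by
  classical
  induction i using Ordinal.limitRecOn with
  | zero =>
    refine ⟨{β 0}, ?_, by simp, by simp, t₁, by simpa using h.first_mem, eqOn_refl _ _, zero_le⟩
    simp
  | add_one j ih =>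
    rw [← Order.succ_eq_add_one] at hi ⊢
    have hj : j < alphaStar := (Order.lt_succ j).trans hi
    obtain ⟨x, hx1, hx2, hx3, t, ht, ht₁, hval⟩ := ih hj
    have hx : (↑(insert (β (Order.succ j)) x) : Set Ordinal.{u}) ⊆ β '' Iic (Order.succ j) := by
      intro γ hγ
      rcases Finset.mem_insert.1 (Finset.mem_coe.1 hγ) with rfl | hγ
      · exact ⟨_, mem_Iic.2 le_rfl, rfl⟩
      · obtain ⟨j', hj', rfl⟩ := hx1 hγ
        exact ⟨j', (mem_Iic.1 hj').trans (Order.le_succ j), rfl⟩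
    have hD := h.finite_mem j hj x hx1
    have hD' := h.finite_mem _ hi _ hx
    have hsub : s ∪ (x : Set Ordinal.{u}) ⊆ s ∪ ↑(insert (β (Order.succ j)) x) :=
      union_subset_union_right s (Finset.coe_subset.2 (Finset.subset_insert _ _))
    obtain ⟨t', ht', htt'⟩ := h.system.exists_extension _ hD _ hD' hsub hs.inl t ht
    have ht'₁ : EqOn t'.mark t₁.mark (s ∪ {β 0}) :=
      (htt'.mono (union_subset_union_right s (singleton_subset_iff.2 hx2))).trans ht₁
    have hmem : β j ∈ s ∪ (x : Set Ordinal.{u}) := Or.inr hx3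
    have hself : β (Order.succ j) ∈ insert (β (Order.succ j)) x := Finset.mem_insert_self _ _
    refine ⟨_, hx, Finset.mem_insert_of_mem hx2, hself, t', ht', ht'₁, ?_⟩
    refine Order.succ_le_of_lt (lt_of_le_of_lt ?_ (h.val_lt_val hs hm hD' subset_union_left ht' ht'₁
      (hsub hmem) (Or.inr hself) (h.le_height j hj) ?_))
    · rw [htt' hmem]
      exact hval
    · rw [htt' hmem]
      refine h.bound_le _ hi x (hx1.trans (image_mono ?_)) t ht _ hx3
      exact fun j' hj' => (mem_Iic.1 hj').trans_lt (Order.lt_succ j)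
  | limit i hlim ih =>
    exact h.exists_witness_limit hs hm hi hlim (hF i hlim) fun j hj => ih j hj (hj.trans hi)

/-- A good play of length `α^*` is impossible: the codomain of `t₁` is less than `α^*`, but by the
move with this number a value outside of it has been forced. -/
theorem IsGoodPlay.false (h : IsGoodPlay s b tStar t₁ F β D L) (h0 : 0 < alphaStar)
    (hs : s.Nonempty) (hm : ∀ γ ∈ s, tStar.mark γ = ⟨1, 0, b⟩)
    (hF : ∀ i, Order.IsSuccLimit i → ∀ φ : Finset Ordinal.{u} → Ordinal.{u}, (∀ x, φ x < i) →
      ∃ k ≤ i, StrictMono (F i k) ∧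
      (∀ m, F i k m < i) ∧ ∀ M, ∃ m, φ ((Finset.range M).image (F i k)) < F i k m) : False := by
  have ha := t₁.mark_cod_lt (β 0)
  obtain ⟨x, hx1, hx2, hx3, t, ht, ht₁, hval⟩ := h.exists_witness hs hm hF _ ha
  refine (h.val_lt_cod h0 hs hm (h.finite_mem _ ha x hx1) ?_ ht ht₁ (Or.inr hx3)
    (h.le_height _ ha)).not_ge hval
  exact union_subset_union_right s (singleton_subset_iff.2 hx2)

end GoodPlay

/-! ### Existence of a good play -/

section Recursion

/-- Transfinite recursion along a relation: if every play that obeys the rule `P` below `i` can be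
continued at `i`, then there is a play of length `a` that obeys the rule. -/
theorem exists_play {X : Type v} [Inhabited X] {a : Ordinal.{u}}
    (P : Ordinal.{u} → (Ordinal.{u} → X) → X → Prop)
    (hcongr : ∀ i < a, ∀ f g v, (∀ j < i, f j = g j) → P i f v → P i g v)
    (hP : ∀ i < a, ∀ f, (∀ j < i, P j f (f j)) → ∃ v, P i f v) : ∃ f, ∀ i < a, P i f (f i) := by
  classical
  set step : ∀ i : Ordinal.{u}, (∀ j, j < i → X) → X := fun i ih =>
    if h : ∃ v, P i (fun j => if hj : j < i then ih j hj else default) v then h.choose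
    else default with hstep
  set f : Ordinal.{u} → X := lt_wf.fix step with hf
  refine ⟨f, fun i => ?_⟩
  induction i using WellFoundedLT.induction with
  | _ i ih =>
    intro hi
    obtain ⟨v, hv⟩ := hP i hi f fun j hj => ih j hj (hj.trans hi)
    have h : ∃ v, P i (fun j => if hj : j < i then f j else default) v :=
      ⟨v, hcongr i hi _ _ _ (fun j hj => by simp [hj]) hv⟩
    have hfi : f i = h.choose := (lt_wf.fix_eq step i).trans (dif_pos h)
    rw [hfi]
    exact hcongr i hi _ _ _ (fun j hj => by simp [hj]) h.choose_spec

end Recursion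

section Responder

variable {lam : Cardinal.{u}} {alphaStar : Ordinal.{u}}

/-- A set of indices that AIS may ask for in one move. -/
def IsDemand (lam : Cardinal.{u}) (Y : Set (Set Ordinal.{u})) : Prop :=
  #Y < Cardinal.lift.{u + 1} lam ∧ ∀ r ∈ Y, r ⊆ Iio lam.ord ∧ r.Countable

/-- What remains of a winning strategy of ISO: if AIS asks for the indices in `Y j` in the `j`-th
move, then `R Y i r` is the set of letters of the element of `𝔾_r` chosen by ISO, for an index `r`
that has been asked for in the first `i` moves. -/
structure IsResponder (s : Set Ordinal.{u}) (tStar : Letter lam alphaStar)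
    (R : (Ordinal.{u} → Set (Set Ordinal.{u})) → Ordinal.{u} → Set Ordinal.{u} →
      Set (Letter lam alphaStar)) : Prop where
  congr : ∀ i ≤ alphaStar, ∀ Y Y', (∀ j < i, Y j = Y' j) → R Y i = R Y' i
  system : ∀ i ≤ alphaStar, ∀ Y, (∀ j < i, IsDemand lam (Y j)) →
    IsLetterSystem {r | ∃ j < i, r ∈ Y j} (R Y i)
  stable : ∀ i ≤ alphaStar, ∀ Y, (∀ j < i, IsDemand lam (Y j)) → ∀ i' ≤ i, ∀ j < i', ∀ r ∈ Y j,
    R Y i' r = R Y i r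
  start : ∀ i ≤ alphaStar, ∀ Y, (∀ j < i, IsDemand lam (Y j)) → ∀ j < i, s ∈ Y j →
    R Y i s = {tStar}

/-- The rule of AIS for his `i`-th move `v = (β i, Y i)`: the height `β i` exceeds all bounds met
before, and he asks for the indices that occur in `IsGoodPlay`. -/
structure IsGoodMove (s : Set Ordinal.{u}) (b : Ordinal.{u})
    (F : Ordinal.{u} → Ordinal.{u} → ℕ → Ordinal.{u})
    (i : Ordinal.{u}) (β : Ordinal.{u} → Ordinal.{u})
    (L : Set Ordinal.{u} → Set (Letter lam alphaStar)) (v : Ordinal.{u} × Set (Set Ordinal.{u})) :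
    Prop where
  le_height : b ≤ v.1
  height_lt : v.1 < lam.ord
  bound_le : ∀ x : Finset Ordinal.{u}, x.Nonempty → ↑x ⊆ β '' Iio i → ∀ t ∈ L (s ∪ x),
    ∀ γ ∈ x, (t.mark γ).bound ≤ v.1
  isDemand : IsDemand lam v.2
  finite_mem : ∀ x : Finset Ordinal.{u}, ↑x ⊆ insert v.1 (β '' Iio i) → s ∪ ↑x ∈ v.2
  ladder_mem : Order.IsSuccLimit i → ∀ t₁ ∈ L (s ∪ {β 0}),
    (∀ j < i, ∃ x, Witness s L β t₁ j x) →
    ∃ w : Ordinal.{u} → Finset Ordinal.{u}, (∀ j < i, Witness s L β t₁ j (w j)) ∧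
      ∀ k ≤ i, (∀ m, F i k m < i) → s ∪ insert v.1 (⋃ m, (w (F i k m) : Set Ordinal.{u})) ∈ v.2

variable {s : Set Ordinal.{u}} {b : Ordinal.{u}} {tStar t₁ : Letter lam alphaStar}
  {F : Ordinal.{u} → Ordinal.{u} → ℕ → Ordinal.{u}} {β β' : Ordinal.{u} → Ordinal.{u}}
  {L L' : Set Ordinal.{u} → Set (Letter lam alphaStar)} {i j : Ordinal.{u}}
  {R : (Ordinal.{u} → Set (Set Ordinal.{u})) → Ordinal.{u} → Set Ordinal.{u} →
      Set (Letter lam alphaStar)}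

theorem insert_image_Iio (β : Ordinal.{u} → Ordinal.{u}) (i : Ordinal.{u}) :
    insert (β i) (β '' Iio i) = β '' Iic i := by
  rw [← image_insert_eq, Iio_insert]

theorem exists_subset_image_Iic {x : Finset Ordinal.{u}} (hne : x.Nonempty)
    (hx : ↑x ⊆ β '' Iio i) : ∃ j < i, ↑x ⊆ β '' Iic j := by
  classical
  obtain ⟨y, hy, rfl⟩ := Finset.subset_set_image_iff.1 hx
  have hne' : y.Nonempty := Finset.image_nonempty.1 hne
  refine ⟨y.max' hne', hy (y.max'_mem hne'), ?_⟩
  rw [Finset.coe_image]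
  exact image_mono fun j hj => mem_Iic.2 (y.le_max' j hj)

theorem Witness.congr {x : Finset Ordinal.{u}} (hβ : ∀ k ≤ j, β k = β' k)
    (hL : ↑x ⊆ β '' Iic j → L (s ∪ x) = L' (s ∪ x)) (h : Witness s L β t₁ j x) :
    Witness s L' β' t₁ j x := by
  obtain ⟨h1, h2, h3, h4⟩ := h
  rw [hL h1] at h4
  rw [hβ 0 zero_le] at h2 h4
  rw [hβ j le_rfl] at h3 h4
  refine ⟨?_, h2, h3, h4⟩
  rwa [← image_congr (f := β) fun k hk => hβ k (mem_Iic.1 hk)]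

theorem IsGoodMove.congr {v : Ordinal.{u} × Set (Set Ordinal.{u})} (hβ : ∀ k < i, β k = β' k)
    (h : IsGoodMove s b F i β L v) : IsGoodMove s b F i β' L v := by
  have himg : β '' Iio i = β' '' Iio i := image_congr fun k hk => hβ k (mem_Iio.1 hk)
  refine ⟨h.le_height, h.height_lt, himg ▸ h.bound_le, h.isDemand, himg ▸ h.finite_mem, ?_⟩
  intro hlim t₁ ht₁ hw
  have hβ' : ∀ j < i, ∀ k ≤ j, β k = β' k := fun j hj k hk => hβ k (hk.trans_lt hj)
  obtain ⟨w, hw1, hw2⟩ := h.ladder_mem hlim t₁ (by rwa [hβ 0 hlim.bot_lt]) fun j hj =>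
    (hw j hj).imp fun x hx => hx.congr (fun k hk => (hβ' j hj k hk).symm) fun _ => rfl
  exact ⟨w, fun j hj => (hw1 j hj).congr (hβ' j hj) fun _ => rfl, hw2⟩

theorem exists_height (hreg : lam.IsRegular) (hunc : ℵ₀ < lam) (hb : b < lam.ord)
    (hi : i < lam.ord)
    (hL : ∀ x : Finset Ordinal.{u}, x.Nonempty → ↑x ⊆ β '' Iio i →
      (L (s ∪ x)).Finite ∧ ∀ t ∈ L (s ∪ x), t.idx.1 = s ∪ x) :
    ∃ v < lam.ord, b ≤ v ∧ ∀ x : Finset Ordinal.{u}, x.Nonempty → ↑x ⊆ β '' Iio i →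
      ∀ t ∈ L (s ∪ x), ∀ γ ∈ x, (t.mark γ).bound ≤ v := by
  have hinf : ℵ₀ ≤ Cardinal.lift.{u + 1} lam := by simpa using hunc.le
  have hcard : #(⋃ x ∈ {x : Finset Ordinal.{u} | ↑x ⊆ β '' Iio i ∧ x.Nonempty},
      ⋃ t ∈ L (s ∪ x), (fun γ => (t.mark γ).bound) '' (x : Set Ordinal.{u}) : Set Ordinal.{u}) <
      Cardinal.lift.{u + 1} lam := by
    refine (card_biUnion_lt_iff_forall_of_isRegular hreg.lift ?_).2 fun x hx => ?_
    · exact (mk_le_mk_of_subset fun x hx => hx.1).trans_lt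
        (mk_finset_subset_lt hinf (mk_image_le.trans_lt (mk_Iio_lt_lift hi)))
    · refine mk_lt_lift_of_countable hunc (Set.Finite.countable ?_)
      exact (hL x hx.2 hx.1).1.biUnion fun t _ => x.finite_toSet.image _
  obtain ⟨v, hv, hlt⟩ := exists_bound hreg hcard (by
    intro γ hγ
    obtain ⟨x, hx, hγ⟩ := mem_iUnion₂.1 hγ
    obtain ⟨t, ht, γ', hγ', rfl⟩ := mem_iUnion₂.1 hγ
    refine t.mark_bound_lt hreg.1 ?_
    rw [(hL x hx.2 hx.1).2 t ht]
    exact Or.inr hγ')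
  refine ⟨max b v, max_lt hb hv, le_max_left _ _, fun x hne hx t ht γ hγ => ?_⟩
  exact (hlt _ (mem_iUnion₂.2 ⟨x, ⟨hx, hne⟩, mem_iUnion₂.2 ⟨t, ht, γ, hγ, rfl⟩⟩)).le.trans
    (le_max_right _ _)

theorem exists_isGoodMove (hreg : lam.IsRegular) (hunc : ℵ₀ < lam) (hb : b < lam.ord)
    (hs : s ⊆ Iio lam.ord) (hsc : s.Countable) (hi : i < lam.ord) (hβ : ∀ j < i, β j < lam.ord)
    (hL : ∀ x : Finset Ordinal.{u}, x.Nonempty → ↑x ⊆ β '' Iio i →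
      (L (s ∪ x)).Finite ∧ ∀ t ∈ L (s ∪ x), t.idx.1 = s ∪ x) :
    ∃ v, IsGoodMove s b F i β L v := by
  classical
  obtain ⟨v, hv, hbv, hbd⟩ := exists_height hreg hunc hb hi hL
  have hinf : ℵ₀ ≤ Cardinal.lift.{u + 1} lam := by simpa using hunc.le
  have hw : ∀ t₁ : Letter lam alphaStar, ∃ w : Ordinal.{u} → Finset Ordinal.{u},
      (∀ j < i, ∃ x, Witness s L β t₁ j x) → ∀ j < i, Witness s L β t₁ j (w j) := by
    intro t₁
    by_cases h : ∀ j < i, ∃ x, Witness s L β t₁ j x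
    · choose! w hw using h
      exact ⟨w, fun _ => hw⟩
    · exact ⟨fun _ => ∅, fun h' => (h h').elim⟩
  choose w hw using hw
  -- the indices asked for
  set Y₁ : Set (Set Ordinal.{u}) := (fun x : Finset Ordinal.{u} => s ∪ ↑x) ''
    {x | ↑x ⊆ insert v (β '' Iio i)} with hY₁
  set Y₂ : Set (Set Ordinal.{u}) := (fun p : Letter lam alphaStar × Ordinal.{u} =>
    s ∪ insert v (⋃ m, (w p.1 (F i p.2 m) : Set Ordinal.{u}))) ''
      (if Order.IsSuccLimit i then L (s ∪ {β 0}) ×ˢ Iic i else ∅) with hY₂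
  set Y := (Y₁ ∪ Y₂) ∩ {r | r ⊆ Iio lam.ord ∧ r.Countable} with hY
  have hYcard : #Y < Cardinal.lift.{u + 1} lam := by
    refine (mk_le_mk_of_subset inter_subset_left).trans_lt ((mk_union_le _ _).trans_lt
      (add_lt_of_lt hinf (mk_image_le.trans_lt (mk_finset_subset_lt hinf ?_))
        (mk_image_le.trans_lt ?_)))
    · refine mk_insert_le.trans_lt (add_lt_of_lt hinf
        (mk_image_le.trans_lt (mk_Iio_lt_lift hi)) ?_)
      exact one_lt_aleph0.trans_le hinf
    · split_ifs with hlim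
      · have h0 : (0 : Ordinal.{u}) < i := hlim.bot_lt
        have hfin := (hL {β 0} (by simp) (by simpa using ⟨0, h0, rfl⟩)).1
        rw [Finset.coe_singleton] at hfin
        rw [mk_setProd]
        refine mul_lt_of_lt hinf ((lt_aleph0_iff_set_finite.2 hfin).trans_le hinf) ?_
        have : Iic i = insert i (Iio i) := Iio_insert.symm
        rw [this]
        exact mk_insert_le.trans_lt (add_lt_of_lt hinf (mk_Iio_lt_lift hi)
          (one_lt_aleph0.trans_le hinf))
      · simpa using (aleph0_pos.trans_le hinf)
  have himg : β '' Iio i ⊆ Iio lam.ord := by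
    rintro _ ⟨j, hj, rfl⟩
    exact hβ j hj
  refine ⟨(v, Y), hbv, hv, hbd, ⟨hYcard, fun r hr => hr.2⟩, ?_, ?_⟩
  · intro x hx
    refine ⟨Or.inl ⟨x, hx, rfl⟩, union_subset hs (hx.trans (insert_subset hv himg)), ?_⟩
    exact hsc.union x.countable_toSet
  · intro hlim t₁ ht₁ h
    refine ⟨w t₁, hw t₁ h, fun k hk hF => ⟨Or.inr ⟨(t₁, k), ?_, rfl⟩, ?_, ?_⟩⟩
    · rw [if_pos hlim]
      exact ⟨ht₁, hk⟩
    · refine union_subset hs (insert_subset hv (iUnion_subset fun m => ?_))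
      refine ((hw t₁ h _ (hF m)).1.trans (image_mono fun j hj => ?_)).trans himg
      exact (mem_Iic.1 hj).trans_lt (hF m)
    · exact hsc.union ((countable_iUnion fun m => (w t₁ (F i k m)).countable_toSet).insert v)

/-- There is no responder: AIS can force a good play. -/
theorem IsResponder.false (hR : IsResponder s tStar R) (hreg : lam.IsRegular) (hunc : ℵ₀ < lam)
    (hle : alphaStar ≤ lam.ord) (h0 : 0 < alphaStar) (hb : b < lam.ord)
    (hs : s ⊆ Iio lam.ord) (hsc : s.Countable) (hne : s.Nonempty)
    (hm : ∀ γ ∈ s, tStar.mark γ = ⟨1, 0, b⟩) : False := by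
  classical
  have hF : ∀ i : Ordinal.{u}, ∃ F : Ordinal.{u} → ℕ → Ordinal.{u}, Order.IsSuccLimit i →
      ∀ φ : Finset Ordinal.{u} → Ordinal.{u}, (∀ x, φ x < i) → ∃ k ≤ i, StrictMono (F k) ∧
        (∀ m, F k m < i) ∧ ∀ M, ∃ m, φ ((Finset.range M).image (F k)) < F k m := by
    intro i
    by_cases hi : Order.IsSuccLimit i
    · obtain ⟨F, hF⟩ := exists_ladder_family hi
      exact ⟨F, fun _ => hF⟩
    · exact ⟨fun _ _ => 0, fun h => (hi h).elim⟩
  choose F hF using hF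
  have hmem : ∀ {f : Ordinal.{u} → Ordinal.{u} × Set (Set Ordinal.{u})} {i : Ordinal.{u}}
      {K : Ordinal.{u} → Set Ordinal.{u} → Set (Letter lam alphaStar)},
      (∀ j < i, IsGoodMove s b F j (fun k => (f k).1) (K j) (f j)) →
      ∀ j < i, ∀ x : Finset Ordinal.{u}, ↑x ⊆ (fun k => (f k).1) '' Iic j →
        s ∪ ↑x ∈ (f j).2 := by
    intro f i K h j hj x hx
    refine (h j hj).finite_mem x ?_
    exact hx.trans_eq (insert_image_Iio (fun k => (f k).1) j).symm
  obtain ⟨f, hf⟩ := exists_play (a := alphaStar)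
    (fun i f v => IsGoodMove s b F i (fun k => (f k).1) (R (fun k => (f k).2) i) v) (by
      intro i hi f g v hfg h
      have h1 := hR.congr i hi.le (fun k => (f k).2) (fun k => (g k).2)
        fun j hj => by rw [hfg j hj]
      rw [← h1]
      exact h.congr fun k hk => by rw [hfg k hk]) (by
      intro i hi f h
      refine exists_isGoodMove hreg hunc hb hs hsc (hi.trans_le hle)
        (fun j hj => (h j hj).height_lt) fun x hxne hx => ?_
      obtain ⟨j, hj, hx'⟩ := exists_subset_image_Iic hxne hx
      have hsys := hR.system i hi.le (fun k => (f k).2) fun j hj => (h j hj).isDemand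
      have hD := hmem h j hj x hx'
      exact ⟨hsys.finite _ ⟨j, hj, hD⟩, hsys.idx_eq _ ⟨j, hj, hD⟩⟩)
  set β : Ordinal.{u} → Ordinal.{u} := fun k => (f k).1 with hβ
  set Y : Ordinal.{u} → Set (Set Ordinal.{u}) := fun k => (f k).2 with hYdef
  have hY : ∀ j < alphaStar, IsDemand lam (Y j) := fun j hj => (hf j hj).isDemand
  have hYmem : ∀ j < alphaStar, ∀ x : Finset Ordinal.{u}, ↑x ⊆ β '' Iic j → s ∪ ↑x ∈ Y j :=
    hmem hf
  have hstable : ∀ i ≤ alphaStar, ∀ j < i, ∀ x : Finset Ordinal.{u}, ↑x ⊆ β '' Iic j →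
      R Y i (s ∪ x) = R Y alphaStar (s ∪ x) := fun i hi j hj x hx =>
    hR.stable _ le_rfl Y hY i hi j hj _ (hYmem j (hj.trans_le hi) x hx)
  have hsys := hR.system _ le_rfl Y hY
  have hs0 : s ∈ Y 0 := by simpa using hYmem 0 h0 ∅ (by simp)
  have hs1 : s ∪ {β 0} ∈ Y 0 := by simpa using hYmem 0 h0 {β 0} (by simp)
  obtain ⟨t₁, ht₁, hmark⟩ := hsys.exists_extension s ⟨0, h0, hs0⟩ _ ⟨0, h0, hs1⟩
    subset_union_left hne tStar (by rw [hR.start _ le_rfl Y hY 0 h0 hs0]; rfl)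
  refine IsGoodPlay.false (s := s) (b := b) (tStar := tStar) (t₁ := t₁) (F := F) (β := β)
    (D := {r | ∃ j < alphaStar, r ∈ Y j}) (L := R Y alphaStar) ⟨hsys, fun i hi =>
    (hf i hi).le_height, ht₁, hmark, ?_, fun i hi x hx => ⟨i, hi, hYmem i hi x hx⟩, ?_⟩
    h0 hne hm hF
  · intro i hi x hx t ht γ hγ
    obtain ⟨j, hj, hx'⟩ := exists_subset_image_Iic ⟨γ, hγ⟩ hx
    rw [← hstable i hi.le j hj x hx'] at ht
    exact (hf i hi).bound_le x ⟨γ, hγ⟩ hx t ht γ hγ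
  · intro i hi hlim h
    have ht₁' : t₁ ∈ R Y i (s ∪ {β 0}) := by
      have h1 := hstable i hi.le 0 hlim.bot_lt {β 0} (by simp)
      rw [Finset.coe_singleton] at h1
      rwa [h1]
    obtain ⟨w, hw1, hw2⟩ := (hf i hi).ladder_mem hlim t₁ ht₁' fun j hj =>
      (h j hj).imp fun x hx => hx.congr (fun _ _ => rfl) fun h' => (hstable i hi.le j hj x h').symm
    exact ⟨w, fun j hj => (hw1 j hj).congr (fun _ _ => rfl) fun h' => hstable i hi.le j hj _ h',
      fun k hk hFk => ⟨i, hi, hw2 k hk hFk⟩⟩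

end Responder

/-! ### ISO loses the game of length `α^*` -/

section Atomic

variable {lam : Cardinal.{u}} {I : Type v} {J : Type w} {x : Parameter lam I J}
  {z₁ z₂ : x.Model} {f : Set (Pointed z₁ × Pointed z₂)}

/-- A point `(r, e)` is mapped into `P_r`. -/
theorem IsPartialIso.exists_image_of_P
    (hf : IsPartialIso (x.lang.withConstants Unit) (Pointed z₁) (Pointed z₂) f) {r : I}
    (h : (⟨r, 1⟩ : x.Model) ∈ Prod.fst '' f) :
    ∃ c : x.G r, ((⟨r, 1⟩, ⟨r, c⟩) : x.Model × x.Model) ∈ f := by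
  obtain ⟨⟨y, r', c⟩, hp, hy⟩ := h
  have hy' : y = (⟨r, 1⟩ : x.Model) := hy
  subst hy'
  have h1 := (hf.rel_iff (n := 1) (Sum.inl (Parameter.RelSymb.P r))
    fun _ => Language.Term.var ⟨_, hp⟩).1 (rfl : r = r)
  have h2 : r' = r := h1
  subst h2
  exact ⟨c, hp⟩

theorem IsPartialIso.image_unique
    (hf : IsPartialIso (x.lang.withConstants Unit) (Pointed z₁) (Pointed z₂) f)
    {r : I} {c c' : x.G r}
    (h : ((⟨r, 1⟩, ⟨r, c⟩) : x.Model × x.Model) ∈ f)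
    (h' : ((⟨r, 1⟩, ⟨r, c'⟩) : x.Model × x.Model) ∈ f) : c = c' := by
  have h1 := (hf.equal_iff (Language.Term.var ⟨_, h⟩) (Language.Term.var ⟨_, h'⟩)).1 rfl
  have h2 : (⟨r, c⟩ : x.Model) = ⟨r, c'⟩ := h1
  exact eq_of_heq (Sigma.mk.inj h2).2

theorem IsPartialIso.image_coherent
    (hf : IsPartialIso (x.lang.withConstants Unit) (Pointed z₁) (Pointed z₂) f)
    {r₀ r : I} {c₀ : x.G r₀} {c : x.G r}
    (h₀ : ((⟨r₀, 1⟩, ⟨r₀, c₀⟩) : x.Model × x.Model) ∈ f)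
    (h : ((⟨r, 1⟩, ⟨r, c⟩) : x.Model × x.Model) ∈ f) (hS : (r₀, r) ∈ x.S) :
    (c₀, c) ∈ x.G₂ r₀ r := by
  have h1 := (hf.rel_iff (n := 2) (Sum.inl (Parameter.RelSymb.Q r₀ r hS))
    ![Language.Term.var ⟨_, h₀⟩, Language.Term.var ⟨_, h⟩]).1
    ((x.Q_mk (1 : x.G r₀) (1 : x.G r)).2 (one_mem _))
  exact (x.Q_mk c₀ c).1 h1

theorem IsPartialIso.image_constant
    (hf : IsPartialIso (x.lang.withConstants Unit) (Pointed z₁) (Pointed z₂) f)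
    {s : I} {a c : x.G s} (hz₁ : z₁ = ⟨s, 1⟩) (hz₂ : z₂ = ⟨s, a⟩)
    (h : ((⟨s, 1⟩, ⟨s, c⟩) : x.Model × x.Model) ∈ f) : c = a := by
  have h1 := (hf.equal_iff (Language.Term.var ⟨_, h⟩)
    (Language.Term.func (l := 0) (Sum.inr () : (x.lang.withConstants Unit).Functions 0)
      Fin.elim0)).1 hz₁.symm
  have h2 : (⟨s, c⟩ : x.Model) = ⟨s, a⟩ := Eq.trans h1 hz₂
  exact eq_of_heq (Sigma.mk.inj h2).2

end Atomic

theorem IsWinningStrategy.mono {L : FirstOrder.Language.{v, w}} {M N : Type u} [L.Structure M]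
    [L.Structure N] {f₀ : Set (M × N)} {α : Ordinal.{o}} {μ : Cardinal.{u}}
    {σ : (Ordinal.{o} → Set M × Set N) → Ordinal.{o} → Set (M × N)}
    (hσ : IsWinningStrategy L f₀ α μ σ) {A : Ordinal.{o} → Set M × Set N} (hA : LegalMoves α μ A)
    {β' β : Ordinal.{o}} (hle : β' ≤ β) (hβ : β ≤ α) : σ A β' ⊆ σ A β := by
  induction β using Ordinal.limitRecOn with
  | zero => rw [le_zero_iff.1 hle]
  | add_one β ih =>
    rw [← Order.succ_eq_add_one] at hle hβ ⊢
    have hβ' := (Order.lt_succ β).trans_le hβ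
    rcases hle.lt_or_eq with h | h
    · exact (ih (Order.lt_succ_iff.1 h) hβ'.le).trans (hσ.succ_extends A hA β hβ')
    · rw [h]
  | limit β hlim _ =>
    rcases hle.lt_or_eq with h | h
    · rw [hσ.limit A hA β hβ hlim]
      exact subset_biUnion_of_mem (u := σ A) (mem_Iio.2 h)
    · rw [h]

section Demand

variable {lam : Cardinal.{u}} {alphaStar : Ordinal.{u}}

/-- The move of AIS asking for the images of `(r, e)` for all indices `r` in `Y`, if this is
legal. -/
def unitMove {K : Type v} (x : Parameter lam (CountableSubsets lam) K) (Y : Set (Set Ordinal.{u})) :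
    Set x.Model :=
  {m | IsDemand lam Y ∧ ∃ r, r.1 ∈ Y ∧ m = ⟨r, 1⟩}

theorem mk_unitMove_lt (hunc : ℵ₀ < lam)
    (x : Parameter lam (CountableSubsets lam) (Letter lam alphaStar)) (Y : Set (Set Ordinal.{u})) :
    #(unitMove x Y) < Cardinal.lift.{u + 1} lam := by
  by_cases h : IsDemand lam Y
  · refine lt_of_le_of_lt ?_ h.1
    have h1 : ∀ m : unitMove x Y, m.1.1.1 ∈ Y := by
      rintro ⟨m, -, r, hr, rfl⟩
      exact hr
    refine mk_le_of_injective (f := fun m => ⟨m.1.1.1, h1 m⟩) fun m m' hm => ?_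
    have h2 : m.1.1 = m'.1.1 := Subtype.ext (congrArg (fun y : Y => y.1) hm)
    obtain ⟨r, -, hr⟩ := m.2.2
    obtain ⟨r', -, hr'⟩ := m'.2.2
    rw [hr, hr'] at h2
    have h3 : r = r' := h2
    exact Subtype.ext (by rw [hr, hr', h3])
  · have : unitMove x Y = ∅ := eq_empty_of_forall_notMem fun m hm => h hm.1
    rw [this, mk_eq_zero]
    exact aleph0_pos.trans_le (by simpa using hunc.le)

/-- ISO has no winning strategy in the game of length `α^*` between `(M, (s, e))` and
`(M, (s, x_t))`, when `t` consists of the root `b` only. -/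
theorem not_pointedEFEquiv (hreg : lam.IsRegular) (hunc : ℵ₀ < lam) (hle : alphaStar ≤ lam.ord)
    (h0 : 0 < alphaStar) (s : CountableSubsets lam) (hne : s.1.Nonempty) {b : Ordinal.{u}}
    (hbl : b < lam.ord) {t : {t // (rootedParameter hreg.1 hle).s t = s}}
    (ht : ∀ γ ∈ s.1, t.1.mark γ = ⟨1, 0, b⟩)
    {z₁ z₂ : (rootedParameter hreg.1 hle).Model} (hz₁ : z₁ = ⟨s, 1⟩)
    (hz₂ : z₂ = ⟨s, FreeGroup.of t⟩) :
    ¬ PointedEFEquiv (rootedParameter hreg.1 hle).lang (rootedParameter hreg.1 hle).Model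
      z₁ z₂ alphaStar (Cardinal.lift.{u + 1} lam) := by
  rintro ⟨σ, hσ⟩
  -- the play in which AIS asks for the indices `Y j` in the `j`-th move
  set A : (Ordinal.{u} → Set (Set Ordinal.{u})) → Ordinal.{u} →
      Set (Pointed z₁) × Set (Pointed z₂) := fun Y j =>
    (unitMove (rootedParameter hreg.1 hle).toParameter (Y j), ∅) with hAdef
  have hA : ∀ Y, LegalMoves alphaStar (Cardinal.lift.{u + 1} lam) (A Y) := by
    intro Y β _
    rw [one_add_lift hunc]
    have h1 : #(A Y β).2 = 0 := mk_eq_zero _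
    rw [h1, add_zero]
    exact mk_unitMove_lt hunc _ (Y β)
  set E : (Ordinal.{u} → Set (Set Ordinal.{u})) → Ordinal.{u} → ∀ r,
      (rootedParameter hreg.1 hle).G r → Prop := fun Y i r c =>
    ((⟨r, 1⟩, ⟨r, c⟩) : (rootedParameter hreg.1 hle).Model × (rootedParameter hreg.1 hle).Model) ∈
      σ (A Y) i with hE
  have huniq : ∀ i ≤ alphaStar, ∀ Y r c c', E Y i r c → E Y i r c' → c = c' :=
    fun i hi Y r c c' h h' => (hσ.partialIso _ (hA Y) i hi).image_unique h h'
  have hmono : ∀ i ≤ alphaStar, ∀ i' ≤ i, ∀ Y r c, E Y i' r c → E Y i r c :=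
    fun i hi i' hi' Y r c h => hσ.mono (hA Y) hi' hi h
  have hex : ∀ i ≤ alphaStar, ∀ Y, (∀ j < i, IsDemand lam (Y j)) → ∀ j < i, ∀ r, r.1 ∈ Y j →
      ∃ c, E Y i r c := by
    intro i hi Y hY j hj r hr
    have h1 := hσ.succ_dom _ (hA Y) j (hj.trans_le hi) ⟨hY j hj, r, hr, rfl⟩
    obtain ⟨c, hc⟩ := (hσ.partialIso _ (hA Y) _
      (Order.succ_le_of_lt (hj.trans_le hi))).exists_image_of_P h1
    exact ⟨c, hmono i hi _ (Order.succ_le_of_lt hj) Y r c hc⟩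
  have hR : IsResponder s.1 t.1 fun Y i => lettersOf hreg.1 hle (E Y i) := by
    refine ⟨?_, ?_, ?_, ?_⟩
    · intro i hi Y Y' h
      have h1 : σ (A Y) i = σ (A Y') i := hσ.nonanticipating _ _ i hi fun j hj =>
        congrArg (fun y => (unitMove (rootedParameter hreg.1 hle).toParameter y, ∅)) (h j hj)
      simp only [hE, h1]
    · intro i hi Y hY
      have h1 := isLetterSystem_lettersOf hreg.1 hle (huniq i hi Y)
        fun r₀ r c₀ c h₀ h hS => (hσ.partialIso _ (hA Y) i hi).image_coherent h₀ h hS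
      have h2 : {r | ∃ j < i, r ∈ Y j} ⊆
          {X | ∃ r : CountableSubsets lam, r.1 = X ∧ ∃ c, E Y i r c} := by
        rintro r ⟨j, hj, hr⟩
        exact ⟨⟨r, (hY j hj).2 r hr⟩, rfl, hex i hi Y hY j hj _ hr⟩
      exact h1.mono h2
    · intro i hi Y hY i' hi' j hj r hr
      obtain ⟨c, hc⟩ := hex i' (hi'.trans hi) Y (fun j hj => hY j (hj.trans_le hi')) j hj
        ⟨r, (hY j (hj.trans_le hi')).2 r hr⟩ hr
      exact (lettersOf_eq hreg.1 hle (huniq i' (hi'.trans hi) Y) hc).trans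
        (lettersOf_eq hreg.1 hle (huniq i hi Y) (hmono i hi i' hi' Y _ c hc)).symm
    · intro i hi Y hY j hj hs
      obtain ⟨c, hc⟩ := hex i hi Y hY j hj s hs
      have h1 : c = FreeGroup.of t := (hσ.partialIso _ (hA Y) i hi).image_constant hz₁ hz₂ hc
      refine (lettersOf_eq hreg.1 hle (huniq i hi Y) hc).trans ?_
      rw [h1, wordLetters_of, image_singleton]
  exact hR.false hreg hunc hle h0 hbl s.2.1 s.2.2 hne ht

end Demand

end LongEF

end

theorem claim1p11 (lam : Cardinal.{u}) (hreg : lam.IsRegular) (hpow : lam ^ ℵ₀ = lam)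
    (alphaStar : Ordinal.{u}) (hle : alphaStar ≤ lam.ord) :
    ∃ (J : Type (u + 1)) (x : LongEF.FullParameter lam (LongEF.CountableSubsets lam) J),
      x.alphaStar = alphaStar ∧ x.IsBounded ℵ₁ ∧ (∀ s, x.u s = s.1) ∧
      (∀ s, x.CondOne Set.univ ⟨s, Set.mem_univ s⟩) ∧
      (∀ s, x.IsRigidAt s) ∧
      (∀ s, s.1.Nonempty → ∀ α, 0 < α → α < alphaStar → ∃ t, x.CondTwo s α t) ∧
      (1 < alphaStar → ∀ s, s.1.Nonempty → ∃ c₁ ∈ x.P s, ∃ c₂ ∈ x.P s, c₁ ≠ c₂ ∧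
        (∀ α < alphaStar, LongEF.PointedEFEquiv x.lang x.Model c₁ c₂
          α (Cardinal.lift.{u + 1} lam)) ∧
        ¬ LongEF.PointedEFEquiv x.lang x.Model c₁ c₂
          alphaStar (Cardinal.lift.{u + 1} lam)) := by
  -- `ℵ₀ ^ ℵ₀ ≠ ℵ₀`, so `lam` is uncountable
  have hunc : ℵ₀ < lam := by
    refine lt_of_le_of_ne hreg.1 ?_
    rintro rfl
    exact (cantor' ℵ₀ one_lt_aleph0).ne' hpow
  refine ⟨LongEF.Letter lam alphaStar, LongEF.rootedParameter hreg.1 hle, rfl, ?_, fun _ => rfl,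
    LongEF.condOne hreg hle, ?_, ?_, ?_⟩
  · intro s
    exact (le_aleph0_iff_set_countable.2 s.2.2).trans_lt (by simp)
  · exact LongEF.Parameter.isRigidAt_of_condOne _ (LongEF.condOne hreg hle)
  · exact fun s _ α h0 hα => LongEF.exists_condTwo hreg hunc hle s h0 hα
  · intro h1 s hne
    obtain ⟨b, hb, hs⟩ := LongEF.exists_bound hreg
      (LongEF.mk_lt_lift_of_countable hunc s.2.2) s.2.1
    have hb0 : 0 < b := hne.elim fun γ hγ => bot_le.trans_lt (hs γ hγ)
    let t := LongEF.Letter.pure s 1 b (fun _ => 0) (LongEF.grows_const h1 hb) hs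
    have ht : ∀ γ ∈ s.1, t.mark γ = ⟨1, 0, b⟩ := by
      intro γ hγ
      exact (LongEF.Letter.pure_mark _ _ hγ).trans (by rw [LongEF.hOf_const])
    let t' : {t // (LongEF.rootedParameter hreg.1 hle).s t = s} := ⟨t, rfl⟩
    refine ⟨⟨s, 1⟩, rfl, ⟨s, FreeGroup.of t'⟩, rfl, ?_, ?_, ?_⟩
    · intro h
      exact FreeGroup.of_ne_one _ (eq_of_heq (Sigma.mk.inj h).2).symm
    · intro α hα
      exact LongEF.pointedEFEquiv_of_lt hreg hunc hle h1 s hb0 hb hs (t := t') ht rfl rfl rfl hα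
    · exact LongEF.not_pointedEFEquiv hreg hunc hle (zero_lt_one.trans h1) s hne hb (t := t') ht
        rfl rfl
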